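/- Let $\mathbb K\in\{\mathbb R,\mathbb C\}$, let $M$ be a smooth, Hausdorff, second countable, finite-dimensional manifold and $E\to M$ a smooth $\mathbb K$-vector bundle of finite rank with dual bundle $E^*$. Let $C^\infty(M)$ (the $\mathbb K$-valued smooth functions), $\Gamma(M,E)$ and $\Gamma(M,E^*)$ (smooth sections) carry their usual Fréchet topologies of uniform convergence of all derivatives on compact sets in charts and local trivializations. A locally convex $C^\infty(M)$-module is a Hausdorff locally convex space over $\mathbb K$ which is a $C^\infty(M)$-module (with compatible scalar multiplication) whose module multiplication is separately continuous. For locally convex $C^\infty(M)$-modules $\mathcal G,\mathcal H$, let $\mathcal G\otimes_\iota\mathcal H$ be the tensor product over $\mathbb K$ with the finest locally convex topology for which $(x,y)\mapsto x\otimes y$ is separately continuous, and let $\mathcal G\otimes_{C^\infty(M),\iota}\mathcal H$ be the quotient of $\mathcal G\otimes_\iota\mathcal H$, with the quotient topology, by the closure of the subgroup generated by all $ax\otimes y-x\otimes ay$ ($a\in C^\infty(M)$, $x\in\mathcal G$, $y\in\mathcal H$); the image of $x\otimes y$ in it is again denoted by $x\otimes y$, and $C^\infty(M)$ acts by $a\,(x\otimes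 y)=(ax)\otimes y$. Let $\mathcal L_{C^\infty(M),\sigma}(\mathcal G,\mathcal H)$ be the space of continuous $C^\infty(M)$-linear maps $\mathcal G\to\mathcal H$ with the topology of pointwise convergence and the action $(a\ell)(x)=a\,\ell(x)$. Then for every locally convex $C^\infty(M)$-module $\mathcal H$, both $\Gamma(M,E)\otimes_{C^\infty(M),\iota}\mathcal H$ and $\mathcal L_{C^\infty(M),\sigma}(\Gamma(M,E^*),\mathcal H)$ are locally convex $C^\infty(M)$-modules, and there is a $C^\infty(M)$-linear homeomorphism $$\Phi\colon\Gamma(M,E)\otimes_{C^\infty(M),\iota}\mathcal H\;\xrightarrow{\ \cong\ }\;\mathcal L_{C^\infty(M),\sigma}\bigl(\Gamma(M,E^*),\mathcal H\bigr)$$ induced by contraction: $\Phi(t\otimes h)(s)=(s\cdot t)\,h$ for all $t\in\Gamma(M,E)$, $h\in\mathcal H$, $s\in\Gamma(M,E^*)$, where $(s\cdot t)(p)=s(p)(t(p))$ for $p\in M$. -/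

import Mathlib

set_option linter.unusedSectionVars false

open scoped Manifold ContDiff Bundle TensorProduct Topology

noncomputable section

/-! ### Locally convex modules -/

/-- `H` is a locally convex module over the topological `𝕜`-algebra `A`: the topology of `H` is
Hausdorff and is given by a family of `𝕜`-seminorms (i.e. `H` is a Hausdorff locally convex
space over `𝕜`), and the multiplication `A × H → H` is separately continuous. -/
class LocallyConvexModule (𝕜 A H : Type*) [RCLike 𝕜] [CommRing A] [Algebra 𝕜 A]
    [TopologicalSpace A] [AddCommGroup H] [Module 𝕜 H] [Module A H] [IsScalarTower 𝕜 A H]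
    [TopologicalSpace H] : Prop where
  polynormableSpace : PolynormableSpace 𝕜 H
  t2Space : T2Space H
  continuous_smul_right : ∀ a : A, Continuous fun x : H => a • x
  continuous_smul_left : ∀ x : H, Continuous fun a : A => a • x

/-! ### The inductive tensor product over the scalar field -/

/-- The algebraic tensor product over `𝕜`, to be endowed with the finest locally convex topology
for which `(x, y) ↦ x ⊗ y` is separately continuous. -/
def InductiveTensor (𝕜 H K : Type*) [RCLike 𝕜] [AddCommGroup H] [Module 𝕜 H] [AddCommGroup K]
    [Module 𝕜 K] : Type _ := H ⊗[𝕜] K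

namespace InductiveTensor

variable {𝕜 A H K : Type*} [RCLike 𝕜] [CommRing A] [Algebra 𝕜 A] [TopologicalSpace A]
  [AddCommGroup H] [Module 𝕜 H] [Module A H] [IsScalarTower 𝕜 A H] [TopologicalSpace H]
  [AddCommGroup K] [Module 𝕜 K] [TopologicalSpace K]

instance : AddCommGroup (InductiveTensor 𝕜 H K) := inferInstanceAs (AddCommGroup (H ⊗[𝕜] K))

instance : Module 𝕜 (InductiveTensor 𝕜 H K) := inferInstanceAs (Module 𝕜 (H ⊗[𝕜] K))

/-- `A` acts on `H ⊗ K` through the left factor. -/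
instance : Module A (InductiveTensor 𝕜 H K) := inferInstanceAs (Module A (H ⊗[𝕜] K))

instance : IsScalarTower 𝕜 A (InductiveTensor 𝕜 H K) :=
  inferInstanceAs (IsScalarTower 𝕜 A (H ⊗[𝕜] K))

/-- The elementary tensor `x ⊗ y`. -/
def tmul (x : H) (y : K) : InductiveTensor 𝕜 H K := x ⊗ₜ[𝕜] y

variable (𝕜 H K) in
/-- The locally convex topologies on `H ⊗ K` making `(x, y) ↦ x ⊗ y` separately continuous. -/
def admissibleTopologies : Set (TopologicalSpace (InductiveTensor 𝕜 H K)) :=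
  {t | PolynormableSpace 𝕜 (InductiveTensor 𝕜 H K) (topology := t) ∧
    (∀ x : H, Continuous[_, t] fun y : K => (tmul x y : InductiveTensor 𝕜 H K)) ∧
    (∀ y : K, Continuous[_, t] fun x : H => (tmul x y : InductiveTensor 𝕜 H K))}

/-- The finest locally convex topology making `(x, y) ↦ x ⊗ y` separately continuous
(in Mathlib's order, finer topologies are smaller; the infimum is attained, see
`sInf_mem_admissibleTopologies`). -/
instance : TopologicalSpace (InductiveTensor 𝕜 H K) := sInf (admissibleTopologies 𝕜 H K)

theorem sInf_mem_admissibleTopologies :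
    sInf (admissibleTopologies 𝕜 H K) ∈ admissibleTopologies 𝕜 H K :=
  ⟨PolynormableSpace.sInf fun _ h => h.1,
    fun x => continuous_sInf_rng.2 fun _ h => h.2.1 x,
    fun y => continuous_sInf_rng.2 fun _ h => h.2.2 y⟩

instance : PolynormableSpace 𝕜 (InductiveTensor 𝕜 H K) := sInf_mem_admissibleTopologies.1

instance : IsTopologicalAddGroup (InductiveTensor 𝕜 H K) :=
  (PolynormableSpace.withSeminorms 𝕜 (InductiveTensor 𝕜 H K)).topologicalAddGroup

instance [LocallyConvexModule 𝕜 A H] : ContinuousConstSMul A (InductiveTensor 𝕜 H K) where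
  continuous_const_smul a := by
    let f : InductiveTensor 𝕜 H K →ₗ[𝕜] InductiveTensor 𝕜 H K :=
      { toFun := fun z => a • z
        map_add' := smul_add a
        map_smul' := fun c z => smul_comm a c z }
    have hf (x : H) (y : K) : f (tmul x y) = tmul (a • x) y := rfl
    obtain ⟨-, h₁, h₂⟩ := sInf_mem_admissibleTopologies (𝕜 := 𝕜) (H := H) (K := K)
    rw [continuous_iff_le_induced]
    refine sInf_le ⟨PolynormableSpace.induced f, fun x => ?_, fun y => ?_⟩
    · rw [continuous_induced_rng]
      exact h₁ (a • x)
    · rw [continuous_induced_rng]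
      exact (h₂ y).comp (LocallyConvexModule.continuous_smul_right 𝕜 a)

end InductiveTensor

/-! ### The inductive tensor product over an algebra -/

/-- The submodule of `H ⊗ K` generated by all `(a • x) ⊗ y - x ⊗ (a • y)`. As this set of
generators is stable under the action of `A`, it does not matter whether one generates an additive
subgroup, a `𝕜`-subspace or an `A`-submodule. -/
def balancingSubmodule (𝕜 A H K : Type*) [RCLike 𝕜] [CommRing A] [Algebra 𝕜 A]
    [AddCommGroup H] [Module 𝕜 H] [Module A H] [IsScalarTower 𝕜 A H]
    [AddCommGroup K] [Module 𝕜 K] [Module A K] : Submodule A (InductiveTensor 𝕜 H K) :=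
  Submodule.span A {z | ∃ (a : A) (x : H) (y : K),
    z = InductiveTensor.tmul (a • x) y - InductiveTensor.tmul x (a • y)}

/-- The inductive tensor product of the locally convex modules `H` and `K` over `A`: the quotient
of `H ⊗ K`, with its finest locally convex topology making `⊗` separately continuous, by the
closure of the subspace generated by all `(a • x) ⊗ y - x ⊗ (a • y)`. -/
def InductiveTensorOver (𝕜 A H K : Type*) [RCLike 𝕜] [CommRing A] [Algebra 𝕜 A]
    [TopologicalSpace A]
    [AddCommGroup H] [Module 𝕜 H] [Module A H] [IsScalarTower 𝕜 A H] [TopologicalSpace H]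
    [AddCommGroup K] [Module 𝕜 K] [Module A K] [TopologicalSpace K]
    [LocallyConvexModule 𝕜 A H] : Type _ :=
  InductiveTensor 𝕜 H K ⧸ (balancingSubmodule 𝕜 A H K).topologicalClosure

namespace InductiveTensorOver

variable {𝕜 A H K : Type*} [RCLike 𝕜] [CommRing A] [Algebra 𝕜 A] [TopologicalSpace A]
  [AddCommGroup H] [Module 𝕜 H] [Module A H] [IsScalarTower 𝕜 A H] [TopologicalSpace H]
  [AddCommGroup K] [Module 𝕜 K] [Module A K] [TopologicalSpace K] [LocallyConvexModule 𝕜 A H]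

instance : AddCommGroup (InductiveTensorOver 𝕜 A H K) :=
  inferInstanceAs (AddCommGroup (_ ⧸ (balancingSubmodule 𝕜 A H K).topologicalClosure))

instance : Module A (InductiveTensorOver 𝕜 A H K) :=
  inferInstanceAs (Module A (_ ⧸ (balancingSubmodule 𝕜 A H K).topologicalClosure))

instance : Module 𝕜 (InductiveTensorOver 𝕜 A H K) :=
  inferInstanceAs (Module 𝕜 (_ ⧸ (balancingSubmodule 𝕜 A H K).topologicalClosure))

instance : IsScalarTower 𝕜 A (InductiveTensorOver 𝕜 A H K) :=
  inferInstanceAs (IsScalarTower 𝕜 A (_ ⧸ (balancingSubmodule 𝕜 A H K).topologicalClosure))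

/-- The quotient topology. -/
instance : TopologicalSpace (InductiveTensorOver 𝕜 A H K) :=
  inferInstanceAs (TopologicalSpace (_ ⧸ (balancingSubmodule 𝕜 A H K).topologicalClosure))

/-- The image of `x ⊗ y` in the quotient. -/
def tmul (x : H) (y : K) : InductiveTensorOver 𝕜 A H K :=
  Submodule.Quotient.mk (InductiveTensor.tmul x y : InductiveTensor 𝕜 H K)

end InductiveTensorOver

/-! ### Continuous linear maps with the topology of simple convergence -/

/-- The continuous `A`-linear maps from `H` to `K`, to be endowed with the topology of pointwise
(simple) convergence. -/
def SimpleHom (𝕜 A H K : Type*) [RCLike 𝕜] [CommRing A] [Algebra 𝕜 A] [TopologicalSpace A]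
    [AddCommGroup H] [Module A H] [TopologicalSpace H]
    [AddCommGroup K] [Module 𝕜 K] [Module A K] [IsScalarTower 𝕜 A K] [TopologicalSpace K]
    [LocallyConvexModule 𝕜 A K] : Type _ := H →L[A] K

namespace SimpleHom

variable {𝕜 A H K : Type*} [RCLike 𝕜] [CommRing A] [Algebra 𝕜 A] [TopologicalSpace A]
  [AddCommGroup H] [Module A H] [TopologicalSpace H]
  [AddCommGroup K] [Module 𝕜 K] [Module A K] [IsScalarTower 𝕜 A K] [TopologicalSpace K]
  [hK : LocallyConvexModule 𝕜 A K]

instance : FunLike (SimpleHom 𝕜 A H K) H K := inferInstanceAs (FunLike (H →L[A] K) H K)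

instance : AddCommGroup (SimpleHom 𝕜 A H K) :=
  haveI := hK.polynormableSpace
  haveI := (PolynormableSpace.withSeminorms 𝕜 K).topologicalAddGroup
  inferInstanceAs (AddCommGroup (H →L[A] K))

/-- The pointwise action `(a • ℓ) s = a • ℓ s`. -/
instance : Module A (SimpleHom 𝕜 A H K) :=
  haveI := hK.polynormableSpace
  haveI := (PolynormableSpace.withSeminorms 𝕜 K).topologicalAddGroup
  haveI : ContinuousConstSMul A K := ⟨hK.continuous_smul_right⟩
  inferInstanceAs (Module A (H →L[A] K))

instance : Module 𝕜 (SimpleHom 𝕜 A H K) :=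
  haveI := hK.polynormableSpace
  haveI := (PolynormableSpace.withSeminorms 𝕜 K).topologicalAddGroup
  haveI := (PolynormableSpace.withSeminorms 𝕜 K).continuousSMul
  haveI : SMulCommClass A 𝕜 K := IsScalarTower.to_smulCommClass'
  inferInstanceAs (Module 𝕜 (H →L[A] K))

instance : IsScalarTower 𝕜 A (SimpleHom 𝕜 A H K) where
  smul_assoc c a ℓ := DFunLike.ext (F := H →L[A] K) _ _ fun s => smul_assoc c a (ℓ s)

/-- The topology of simple convergence. -/
instance : TopologicalSpace (SimpleHom 𝕜 A H K) :=
  TopologicalSpace.induced (fun ℓ (s : H) => ℓ s) inferInstance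

end SimpleHom

/-! ### Smooth functions, smooth vector bundles and their sections -/

/-- The algebra `C^∞(M)` of smooth `𝕜`-valued functions on the real manifold `M`. -/
abbrev SmoothFn (𝕜 EM M : Type*) [RCLike 𝕜] [NormedAddCommGroup EM] [NormedSpace ℝ EM]
    [TopologicalSpace M] [ChartedSpace EM M] : Type _ := C^∞⟮𝓘(ℝ, EM), M; 𝓘(ℝ, 𝕜), 𝕜⟯

/-- Smoothness, over `ℝ`, of a `𝕜`-vector bundle `E` of typical fibre `F`, where `𝕜` is `ℝ` or
`ℂ`: the transition functions between the local trivializations are (real) smooth. -/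
class SmoothVectorBundle (𝕜 EM : Type*) {M : Type*} (F : Type*) (E : M → Type*) [RCLike 𝕜]
    [NormedAddCommGroup EM] [NormedSpace ℝ EM] [TopologicalSpace M] [ChartedSpace EM M]
    [NormedAddCommGroup F] [NormedSpace ℝ F] [NormedSpace 𝕜 F] [IsScalarTower ℝ 𝕜 F]
    [∀ x, AddCommGroup (E x)] [∀ x, Module 𝕜 (E x)] [∀ x, TopologicalSpace (E x)]
    [TopologicalSpace (Bundle.TotalSpace F E)] [FiberBundle F E] [VectorBundle 𝕜 F E] : Prop where
  contMDiffOn_coordChangeL : ∀ (e e' : Bundle.Trivialization F (Bundle.TotalSpace.proj : Bundle.TotalSpace F E → M))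
    [MemTrivializationAtlas e] [MemTrivializationAtlas e'],
    ContMDiffOn 𝓘(ℝ, EM) 𝓘(ℝ, F →L[𝕜] F) ∞ (fun b : M => (e.coordChangeL 𝕜 e' b : F →L[𝕜] F))
      (e.baseSet ∩ e'.baseSet)

/-- The space `Γ(M, E)` of smooth sections of the `𝕜`-vector bundle `E`: those `s` for which
`x ↦ s x` is a smooth map from `M` to the total space of `E`. -/
structure SmoothSection (𝕜 EM : Type*) {M : Type*} (F : Type*) (E : M → Type*)
    [NormedAddCommGroup EM] [NormedSpace ℝ EM] [TopologicalSpace M] [ChartedSpace EM M]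
    [NormedAddCommGroup F] [NormedSpace ℝ F] [∀ x, TopologicalSpace (E x)]
    [TopologicalSpace (Bundle.TotalSpace F E)] [FiberBundle F E] where
  toFun : Π x, E x
  contMDiff : ContMDiff 𝓘(ℝ, EM) (𝓘(ℝ, EM).prod 𝓘(ℝ, F)) ∞
    fun x => Bundle.TotalSpace.mk' F x (toFun x)

/-- The fibres of the dual bundle `E^*`. Mathlib equips this family with the structure of a vector
bundle with typical fibre `F →L[𝕜] 𝕜`. -/
abbrev DualBundle (𝕜 : Type*) {M : Type*} (E : M → Type*) [RCLike 𝕜] [∀ x, AddCommGroup (E x)]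
    [∀ x, Module 𝕜 (E x)] [∀ x, TopologicalSpace (E x)] (x : M) : Type _ :=
  E x →L[𝕜] Bundle.Trivial M 𝕜 x

section Bundle

variable {𝕜 EM M F : Type*} {E : M → Type*} [RCLike 𝕜]
  [NormedAddCommGroup EM] [NormedSpace ℝ EM] [TopologicalSpace M] [ChartedSpace EM M]
  [NormedAddCommGroup F] [NormedSpace ℝ F] [NormedSpace 𝕜 F] [IsScalarTower ℝ 𝕜 F]
  [∀ x, AddCommGroup (E x)] [∀ x, Module 𝕜 (E x)] [∀ x, TopologicalSpace (E x)]
  [TopologicalSpace (Bundle.TotalSpace F E)] [FiberBundle F E] [VectorBundle 𝕜 F E]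

instance : ContMDiffRing 𝓘(ℝ, 𝕜) ∞ 𝕜 :=
  { (inferInstance : LieAddGroup 𝓘(ℝ, 𝕜) ∞ 𝕜) with
    contMDiff_mul := by
      rw [← modelWithCornersSelf_prod, chartedSpaceSelf_prod]
      exact contDiff_mul.contMDiff }

/-- The `𝕜`-algebra structure of `C^∞(M)` with the pointwise scalar multiplication. -/
instance : Algebra 𝕜 (SmoothFn 𝕜 EM M) where
  smul c f := ⟨fun x => c * f x, contMDiff_const.mul f.contMDiff⟩
  algebraMap :=
    { toFun := fun c => ⟨fun _ => c, contMDiff_const⟩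
      map_one' := rfl
      map_mul' := fun _ _ => rfl
      map_zero' := rfl
      map_add' := fun _ _ => rfl }
  commutes' c f := by ext x; exact mul_comm _ _
  smul_def' c f := rfl

namespace SmoothSection

instance : CoeFun (SmoothSection 𝕜 EM F E) fun _ => Π x, E x := ⟨toFun⟩

theorem ext {s t : SmoothSection 𝕜 EM F E} (h : ∀ x, s x = t x) : s = t := by
  cases s
  cases t
  congr
  exact funext h

instance : Zero (SmoothSection 𝕜 EM F E) where
  zero := ⟨fun _ => 0, fun x₀ => by
    rw [Bundle.contMDiffAt_section]
    refine (contMDiffAt_const (c := (0 : F))).congr_of_eventuallyEq ?_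
    filter_upwards [(trivializationAt F E x₀).open_baseSet.mem_nhds
      (FiberBundle.mem_baseSet_trivializationAt' x₀)] with x hx
    exact ((trivializationAt F E x₀).linear 𝕜 hx).map_zero⟩

instance : Add (SmoothSection 𝕜 EM F E) where
  add s t := ⟨fun x => s x + t x, fun x₀ => by
    have hs := s.contMDiff x₀
    have ht := t.contMDiff x₀
    rw [Bundle.contMDiffAt_section] at hs ht ⊢
    refine (hs.add ht).congr_of_eventuallyEq ?_
    filter_upwards [(trivializationAt F E x₀).open_baseSet.mem_nhds
      (FiberBundle.mem_baseSet_trivializationAt' x₀)] with x hx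
    exact ((trivializationAt F E x₀).linear 𝕜 hx).map_add _ _⟩

instance : Neg (SmoothSection 𝕜 EM F E) where
  neg s := ⟨fun x => -s x, fun x₀ => by
    have hs := s.contMDiff x₀
    rw [Bundle.contMDiffAt_section] at hs ⊢
    refine hs.neg.congr_of_eventuallyEq ?_
    filter_upwards [(trivializationAt F E x₀).open_baseSet.mem_nhds
      (FiberBundle.mem_baseSet_trivializationAt' x₀)] with x hx
    exact ((trivializationAt F E x₀).linear 𝕜 hx).map_neg _⟩

instance : AddCommGroup (SmoothSection 𝕜 EM F E) where
  add_assoc _ _ _ := ext fun _ => add_assoc _ _ _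
  zero_add _ := ext fun _ => zero_add _
  add_zero _ := ext fun _ => add_zero _
  neg_add_cancel _ := ext fun _ => neg_add_cancel _
  add_comm _ _ := ext fun _ => add_comm _ _
  nsmul := nsmulRec
  zsmul := zsmulRec

instance : Module 𝕜 (SmoothSection 𝕜 EM F E) where
  smul c s := ⟨fun x => c • s x, fun x₀ => by
    have hs := s.contMDiff x₀
    rw [Bundle.contMDiffAt_section] at hs ⊢
    have : ContMDiffAt 𝓘(ℝ, EM) 𝓘(ℝ, F) ∞ (fun x => c • (trivializationAt F E x₀ ⟨x, s x⟩).2) x₀ :=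
      (contDiff_const_smul (𝕜 := ℝ) (F := F) c).contMDiff.contMDiffAt.comp x₀ hs
    refine this.congr_of_eventuallyEq ?_
    filter_upwards [(trivializationAt F E x₀).open_baseSet.mem_nhds
      (FiberBundle.mem_baseSet_trivializationAt' x₀)] with x hx
    exact ((trivializationAt F E x₀).linear 𝕜 hx).map_smul _ _⟩
  one_smul s := ext fun x => one_smul _ _
  mul_smul f g s := ext fun x => mul_smul _ _ _
  smul_zero f := ext fun x => smul_zero _
  smul_add f s t := ext fun x => smul_add _ _ _
  add_smul f g s := ext fun x => add_smul _ _ _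
  zero_smul s := ext fun x => zero_smul _ _

/-- `C^∞(M)` acts on `Γ(M, E)` pointwise. -/
instance : Module (SmoothFn 𝕜 EM M) (SmoothSection 𝕜 EM F E) where
  smul f s := ⟨fun x => f x • s x, fun x₀ => by
    have hs := s.contMDiff x₀
    rw [Bundle.contMDiffAt_section] at hs ⊢
    have hf : ContMDiffAt 𝓘(ℝ, EM) 𝓘(ℝ, 𝕜) ∞ f x₀ := f.contMDiff x₀
    have : ContMDiffAt 𝓘(ℝ, EM) 𝓘(ℝ, F) ∞
        (fun x => f x • (trivializationAt F E x₀ ⟨x, s x⟩).2) x₀ :=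
      ((ContinuousLinearMap.lsmul ℝ 𝕜 : 𝕜 →L[ℝ] F →L[ℝ] F).contMDiff.contMDiffAt.comp x₀ hf).clm_apply hs
    refine this.congr_of_eventuallyEq ?_
    filter_upwards [(trivializationAt F E x₀).open_baseSet.mem_nhds
      (FiberBundle.mem_baseSet_trivializationAt' x₀)] with x hx
    exact ((trivializationAt F E x₀).linear 𝕜 hx).map_smul _ _⟩
  one_smul s := ext fun x => one_smul _ _
  mul_smul f g s := ext fun x => mul_smul _ _ _
  smul_zero f := ext fun x => smul_zero _
  smul_add f s t := ext fun x => smul_add _ _ _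
  add_smul f g s := ext fun x => add_smul _ _ _
  zero_smul s := ext fun x => zero_smul _ _

instance : IsScalarTower 𝕜 (SmoothFn 𝕜 EM M) (SmoothSection 𝕜 EM F E) where
  smul_assoc c f s := ext fun x => mul_smul c (f x) (s x)

end SmoothSection

/-- The dual of a smooth vector bundle is smooth. -/
instance DualBundle.smoothVectorBundle [SmoothVectorBundle 𝕜 EM F E] :
    SmoothVectorBundle 𝕜 EM (F →L[𝕜] 𝕜) (DualBundle 𝕜 E) where
  contMDiffOn_coordChangeL := by
    rintro _ _ ⟨_, ⟨e₁, e₂, he₁, he₂, rfl⟩, rfl⟩ ⟨_, ⟨e₁', e₂', he₁', he₂', rfl⟩, rfl⟩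
    obtain rfl := Bundle.Trivial.eq_trivialization M 𝕜 e₂
    obtain rfl := Bundle.Trivial.eq_trivialization M 𝕜 e₂'
    have h := SmoothVectorBundle.contMDiffOn_coordChangeL (𝕜 := 𝕜) (EM := EM) e₁' e₁
    have hB : ContDiff 𝕜 ∞ (ContinuousLinearMap.compL 𝕜 F F 𝕜).flip :=
      ContinuousLinearMap.contDiff _
    have hc := (hB.restrict_scalars ℝ).contMDiff
    refine ((hc.comp_contMDiffOn h).mono ?_).congr ?_
    · rintro b ⟨hb, hb'⟩
      exact ⟨hb'.1, hb.1⟩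
    · rintro b ⟨hb, hb'⟩
      ext L v
      have h₁ := Bundle.Pretrivialization.continuousLinearMapCoordChange_apply (RingHom.id 𝕜)
        e₁ e₁' (Bundle.Trivial.trivialization M 𝕜) (Bundle.Trivial.trivialization M 𝕜) b
        ⟨hb, hb'⟩ L
      rw [ContinuousLinearEquiv.coe_coe, Bundle.Trivialization.coordChangeL_apply]
      swap
      · exact ⟨hb, hb'⟩
      refine (DFunLike.congr_fun h₁.symm v).trans ?_
      simp [Bundle.Pretrivialization.continuousLinearMapCoordChange,
        Bundle.Trivial.trivialization.coordChangeL]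

/-- The contraction of a section of `E^*` with a section of `E`, `x ↦ s(x)(t(x))`. -/
def contraction (s : SmoothSection 𝕜 EM (F →L[𝕜] 𝕜) (DualBundle 𝕜 E))
    (t : SmoothSection 𝕜 EM F E) : SmoothFn 𝕜 EM M :=
  ⟨fun x => s x (t x), fun x₀ => by
    have hs := s.contMDiff x₀
    have ht := t.contMDiff x₀
    rw [Bundle.contMDiffAt_section] at hs ht
    have : ContMDiffAt 𝓘(ℝ, EM) 𝓘(ℝ, 𝕜) ∞ (fun x =>
        (trivializationAt (F →L[𝕜] 𝕜) (DualBundle 𝕜 E) x₀ ⟨x, s x⟩).2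
          (trivializationAt F E x₀ ⟨x, t x⟩).2) x₀ :=
      ((ContinuousLinearMap.restrictScalarsL 𝕜 F 𝕜 ℝ ℝ).contMDiff.contMDiffAt.comp x₀ hs).clm_apply ht
    refine this.congr_of_eventuallyEq ?_
    filter_upwards [(trivializationAt F E x₀).open_baseSet.mem_nhds
      (FiberBundle.mem_baseSet_trivializationAt' x₀)] with x hx
    rw [hom_trivializationAt_apply]
    change _ = ContinuousLinearMap.inCoordinates F E 𝕜 (Bundle.Trivial M 𝕜) x₀ x x₀ x (s x) _
    rw [ContinuousLinearMap.inCoordinates, ContinuousLinearMap.comp_apply,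
      ContinuousLinearMap.comp_apply, Bundle.Trivialization.symmL_apply _ hx,
      Bundle.Trivialization.symm_apply_apply_mk _ hx]
    exact (DFunLike.congr_fun (Bundle.Trivial.continuousLinearMapAt_trivialization 𝕜 M 𝕜 x)
      (s x (t x))).symm⟩

/-! ### The Fréchet topologies -/

section Topology

variable {G S : Type*} [NormedAddCommGroup G] [NormedSpace ℝ G] [NormedSpace 𝕜 G]
  [IsScalarTower ℝ 𝕜 G] [AddCommGroup S] [Module 𝕜 S]

/-- `supDeriv U K k g` is the supremum over `K` of the norm of the `k`-th derivative of `g`,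
where `K` is a subset of the open set `U` on which `g` is defined. -/
def supDeriv (U K : Set EM) (k : ℕ) (g : EM → G) : ℝ :=
  ⨆ y : K, ‖iteratedFDerivWithin ℝ k g U y‖

theorem supDeriv_nonneg (U K : Set EM) (k : ℕ) (g : EM → G) : 0 ≤ supDeriv U K k g :=
  Real.iSup_nonneg fun _ => norm_nonneg _

theorem supDeriv_congr {U K : Set EM} (hKU : K ⊆ U) (k : ℕ) {g g' : EM → G}
    (h : Set.EqOn g g' U) : supDeriv U K k g = supDeriv U K k g' :=
  iSup_congr fun y => by rw [iteratedFDerivWithin_congr h (hKU y.2)]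

theorem le_supDeriv {U K : Set EM} (hU : IsOpen U) (hK : IsCompact K) (hKU : K ⊆ U) (k : ℕ)
    {g : EM → G} (hg : ContDiffOn ℝ ∞ g U) {y : EM} (hy : y ∈ K) :
    ‖iteratedFDerivWithin ℝ k g U y‖ ≤ supDeriv U K k g := by
  obtain ⟨C, hC⟩ := hK.exists_bound_of_continuousOn
    ((hg.continuousOn_iteratedFDerivWithin (m := k) (by exact_mod_cast le_top)
      hU.uniqueDiffOn).mono hKU)
  exact le_ciSup (f := fun y : K => ‖iteratedFDerivWithin ℝ k g U y‖)
    ⟨C, by rintro _ ⟨y, rfl⟩; exact hC y y.2⟩ ⟨y, hy⟩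

/-- The seminorm `s ↦ sup_K ‖D^k (r s)‖` on a space `S` of objects which have smooth local
representatives `r s` on the open set `U ⊇ K`. -/
def supDerivSeminorm {U K : Set EM} (hU : IsOpen U) (hK : IsCompact K) (hKU : K ⊆ U) (k : ℕ)
    (r : S → EM → G) (hr : ∀ s, ContDiffOn ℝ ∞ (r s) U)
    (hadd : ∀ s t, Set.EqOn (r (s + t)) (r s + r t) U)
    (hsmul : ∀ (c : 𝕜) (s), Set.EqOn (r (c • s)) (c • r s) U) : Seminorm 𝕜 S :=
  Seminorm.of (fun s => supDeriv U K k (r s))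
    (fun s t => by
      rw [supDeriv_congr hKU k (hadd s t)]
      refine Real.iSup_le (fun y => ?_) (add_nonneg (supDeriv_nonneg ..) (supDeriv_nonneg ..))
      have h (s) : ContDiffWithinAt ℝ k (r s) U y :=
        ((hr s).of_le (by exact_mod_cast le_top)) y (hKU y.2)
      rw [iteratedFDerivWithin_add_apply (h s) (h t) hU.uniqueDiffOn (hKU y.2)]
      exact (norm_add_le _ _).trans (add_le_add (le_supDeriv hU hK hKU k (hr s) y.2)
        (le_supDeriv hU hK hKU k (hr t) y.2)))
    (fun c s => by
      rw [supDeriv_congr hKU k (hsmul c s), supDeriv, supDeriv,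
        Real.mul_iSup_of_nonneg (norm_nonneg c)]
      refine iSup_congr fun y => ?_
      rw [iteratedFDerivWithin_const_smul_apply (((hr s).of_le (by exact_mod_cast le_top)) y
        (hKU y.2)) hU.uniqueDiffOn (hKU y.2), norm_smul])

theorem continuous_of_le_continuous [TopologicalSpace S] [IsTopologicalAddGroup S]
    (p : Seminorm 𝕜 S) {g : S → ℝ} (hg : Continuous g) (h0 : g 0 = 0) (h : ∀ x, p x ≤ g x) :
    Continuous p := by
  refine Seminorm.continuous_of_continuousAt_zero ?_
  rw [ContinuousAt, map_zero]
  refine squeeze_zero (fun x => apply_nonneg p x) h ?_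
  simpa [h0] using hg.tendsto 0

end Topology

section ChartDomain

variable (EM M) in
/-- Indices of the seminorms on `C^∞(M)`: a point (determining a chart around it), a compact subset
of the image of this chart, and an order of differentiation. -/
structure FnIndex where
  pt : M
  K : Set EM
  isCompact : IsCompact K
  subset : K ⊆ (chartAt EM pt).target
  order : ℕ

variable (EM F E) in
/-- The open set, in the image of the chart at `x₀`, over which the trivialization of `E` at `x₀` is
defined. -/
def chartDomain (x₀ : M) : Set EM :=
  (chartAt EM x₀).target ∩ (chartAt EM x₀).symm ⁻¹' (trivializationAt F E x₀).baseSet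

theorem isOpen_chartDomain (x₀ : M) : IsOpen (chartDomain EM F E x₀) :=
  (chartAt EM x₀).isOpen_inter_preimage_symm (trivializationAt F E x₀).open_baseSet

variable (EM F E) in
/-- Indices of the seminorms on `Γ(M, E)`. -/
structure SectionIndex where
  pt : M
  K : Set EM
  isCompact : IsCompact K
  subset : K ⊆ chartDomain EM F E pt
  order : ℕ

end ChartDomain

namespace SmoothFn

/-- The representative of a function in the chart at `x₀`. -/
def localRep (x₀ : M) (f : SmoothFn 𝕜 EM M) : EM → 𝕜 := fun y => f ((chartAt EM x₀).symm y)

variable [IsManifold 𝓘(ℝ, EM) ∞ M]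

theorem contDiffOn_localRep (x₀ : M) (f : SmoothFn 𝕜 EM M) :
    ContDiffOn ℝ ∞ (localRep x₀ f) (chartAt EM x₀).target :=
  contMDiffOn_iff_contDiffOn.1 (f.contMDiff.comp_contMDiffOn contMDiffOn_chart_symm)

variable (𝕜 EM M) in
/-- The seminorms `f ↦ sup_K ‖D^k (f ∘ φ⁻¹)‖` for charts `φ`, compact subsets `K` of the image of
`φ`, and `k ∈ ℕ`. -/
def seminorms : SeminormFamily 𝕜 (SmoothFn 𝕜 EM M) (FnIndex EM M) := fun i =>
  supDerivSeminorm (chartAt EM i.pt).open_target i.isCompact i.subset i.order (localRep i.pt)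
    (contDiffOn_localRep i.pt) (fun _ _ _ _ => rfl) (fun _ _ _ _ => rfl)

/-- The usual Fréchet topology of `C^∞(M)`: uniform convergence of all derivatives on compact
sets, in charts. -/
instance : TopologicalSpace (SmoothFn 𝕜 EM M) := (seminorms 𝕜 EM M).moduleFilterBasis.topology

theorem withSeminorms : WithSeminorms (seminorms 𝕜 EM M) := ⟨rfl⟩

end SmoothFn

namespace SmoothSection

/-- The representative of a section in the chart and the trivialization at `x₀`. -/
def localRep (x₀ : M) (s : SmoothSection 𝕜 EM F E) : EM → F := fun y =>
  (trivializationAt F E x₀ ⟨(chartAt EM x₀).symm y, s ((chartAt EM x₀).symm y)⟩).2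

variable [IsManifold 𝓘(ℝ, EM) ∞ M] [SmoothVectorBundle 𝕜 EM F E]

theorem contDiffOn_localRep (x₀ : M) (s : SmoothSection 𝕜 EM F E) :
    ContDiffOn ℝ ∞ (localRep x₀ s) (chartDomain EM F E x₀) := by
  rw [← contMDiffOn_iff_contDiffOn]
  have key : ContMDiffOn 𝓘(ℝ, EM) 𝓘(ℝ, F) ∞ (fun x => (trivializationAt F E x₀ ⟨x, s x⟩).2)
      (trivializationAt F E x₀).baseSet := by
    intro x₁ hx₁
    have hs := s.contMDiff x₁
    rw [Bundle.contMDiffAt_section] at hs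
    have hx₁' := FiberBundle.mem_baseSet_trivializationAt' (F := F) (E := E) x₁
    have hU := ((trivializationAt F E x₁).open_baseSet.inter
      (trivializationAt F E x₀).open_baseSet).mem_nhds ⟨hx₁', hx₁⟩
    have hc := (SmoothVectorBundle.contMDiffOn_coordChangeL (𝕜 := 𝕜) (EM := EM)
      (trivializationAt F E x₁) (trivializationAt F E x₀)).contMDiffAt hU
    refine (((ContinuousLinearMap.restrictScalarsL 𝕜 F F ℝ ℝ).contMDiff.contMDiffAt.comp x₁
      hc).clm_apply hs).congr_of_eventuallyEq ?_ |>.contMDiffWithinAt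
    filter_upwards [hU] with x hx
    simp [Bundle.Trivialization.coordChangeL_apply _ _ hx,
      Bundle.Trivialization.symm_apply_apply_mk _ hx.1]
  exact key.comp (contMDiffOn_chart_symm.mono Set.inter_subset_left) fun y hy => hy.2

theorem localRep_add (x₀ : M) (s t : SmoothSection 𝕜 EM F E) :
    Set.EqOn (localRep x₀ (s + t)) (localRep x₀ s + localRep x₀ t) (chartDomain EM F E x₀) :=
  fun _ hy => ((trivializationAt F E x₀).linear 𝕜 hy.2).map_add _ _

theorem localRep_smul (x₀ : M) (c : 𝕜) (s : SmoothSection 𝕜 EM F E) :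
    Set.EqOn (localRep x₀ (c • s)) (c • localRep x₀ s) (chartDomain EM F E x₀) :=
  fun _ hy => ((trivializationAt F E x₀).linear 𝕜 hy.2).map_smul _ _

variable (𝕜 EM F E) in
/-- The seminorms `s ↦ sup_K ‖D^k s_φ‖`, where `s_φ` is the representative of `s` in a chart `φ` and
a local trivialization of `E`, `K` is a compact subset of the domain of `s_φ`, and `k ∈ ℕ`. -/
def seminorms : SeminormFamily 𝕜 (SmoothSection 𝕜 EM F E) (SectionIndex EM F E) := fun i =>
  supDerivSeminorm (isOpen_chartDomain i.pt) i.isCompact i.subset i.order (localRep i.pt)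
    (contDiffOn_localRep i.pt) (localRep_add i.pt) (localRep_smul i.pt)

/-- The usual Fréchet topology of `Γ(M, E)`: uniform convergence of all derivatives on compact
sets, in charts and local trivializations. -/
instance : TopologicalSpace (SmoothSection 𝕜 EM F E) :=
  (seminorms 𝕜 EM F E).moduleFilterBasis.topology

theorem withSeminorms : WithSeminorms (seminorms 𝕜 EM F E) := ⟨rfl⟩

theorem seminorms_smul_le (f : SmoothFn 𝕜 EM M) (s : SmoothSection 𝕜 EM F E)
    (i : SectionIndex EM F E) : seminorms 𝕜 EM F E i (f • s) ≤
      ∑ j ∈ Finset.range (i.order + 1), (i.order.choose j : ℝ) *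
        SmoothFn.seminorms 𝕜 EM M ⟨i.pt, i.K, i.isCompact, fun _ hy => (i.subset hy).1, j⟩ f *
        seminorms 𝕜 EM F E ⟨i.pt, i.K, i.isCompact, i.subset, i.order - j⟩ s := by
  have hU := isOpen_chartDomain (EM := EM) (F := F) (E := E) i.pt
  have hT := (chartAt EM i.pt).open_target
  have hf := SmoothFn.contDiffOn_localRep i.pt f
  have hf' : ContDiffOn ℝ ∞ (SmoothFn.localRep i.pt f) (chartDomain EM F E i.pt) :=
    hf.mono Set.inter_subset_left
  have hs := contDiffOn_localRep i.pt s
  have heq : Set.EqOn (localRep i.pt (f • s))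
      (fun y => SmoothFn.localRep i.pt f y • localRep i.pt s y) (chartDomain EM F E i.pt) :=
    fun _ hy => ((trivializationAt F E i.pt).linear 𝕜 hy.2).map_smul _ _
  change supDeriv _ _ _ _ ≤ _
  rw [supDeriv_congr i.subset _ heq]
  refine Real.iSup_le (fun y => ?_) (Finset.sum_nonneg fun j _ => ?_)
  · have hy := i.subset y.2
    refine (norm_iteratedFDerivWithin_smul_le hf' hs hU.uniqueDiffOn hy
      (by exact_mod_cast le_top)).trans (Finset.sum_le_sum fun j _ => ?_)
    have h₁ : ‖iteratedFDerivWithin ℝ j (SmoothFn.localRep i.pt f) (chartDomain EM F E i.pt) y‖ ≤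
        SmoothFn.seminorms 𝕜 EM M ⟨i.pt, i.K, i.isCompact, fun _ hy => (i.subset hy).1, j⟩ f := by
      rw [iteratedFDerivWithin_of_isOpen j hU hy, ← iteratedFDerivWithin_of_isOpen j hT hy.1]
      exact le_supDeriv hT i.isCompact (fun _ hy => (i.subset hy).1) j hf y.2
    have h₂ : ‖iteratedFDerivWithin ℝ (i.order - j) (localRep i.pt s)
        (chartDomain EM F E i.pt) y‖ ≤
        seminorms 𝕜 EM F E ⟨i.pt, i.K, i.isCompact, i.subset, i.order - j⟩ s :=
      le_supDeriv hU i.isCompact i.subset _ hs y.2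
    gcongr
  · have h₁ := apply_nonneg (SmoothFn.seminorms 𝕜 EM M
      ⟨i.pt, i.K, i.isCompact, fun _ hy => (i.subset hy).1, j⟩) f
    have h₂ := apply_nonneg (seminorms 𝕜 EM F E
      ⟨i.pt, i.K, i.isCompact, i.subset, i.order - j⟩) s
    positivity

/-- `Γ(M, E)` is a locally convex `C^∞(M)`-module. -/
instance : LocallyConvexModule 𝕜 (SmoothFn 𝕜 EM M) (SmoothSection 𝕜 EM F E) where
  polynormableSpace := withSeminorms.toPolynormableSpace
  t2Space := by
    have hs := withSeminorms (𝕜 := 𝕜) (EM := EM) (F := F) (E := E)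
    have := hs.topologicalAddGroup
    have := hs.T1_of_separating fun s hs => by
      obtain ⟨x, hx⟩ : ∃ x, s x ≠ 0 := by
        by_contra! h
        exact hs (ext h)
      have hx₀ := FiberBundle.mem_baseSet_trivializationAt' (F := F) (E := E) x
      have hy : chartAt EM x x ∈ chartDomain EM F E x := by
        refine ⟨mem_chart_target EM x, ?_⟩
        rwa [Set.mem_preimage, (chartAt EM x).left_inv (mem_chart_source EM x)]
      refine ⟨⟨x, {chartAt EM x x}, isCompact_singleton, Set.singleton_subset_iff.2 hy, 0⟩, ?_⟩
      refine ne_of_gt (lt_of_lt_of_le ?_ (le_supDeriv (isOpen_chartDomain x) isCompact_singleton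
        (Set.singleton_subset_iff.2 hy) 0 (contDiffOn_localRep x s) rfl))
      rw [norm_iteratedFDerivWithin_zero, norm_pos_iff, localRep,
        (chartAt EM x).left_inv (mem_chart_source EM x)]
      intro h
      refine hx (((trivializationAt F E x).linearEquivAt 𝕜 x hx₀).map_eq_zero_iff.1 h)
    infer_instance
  continuous_smul_right f := by
    have hs := withSeminorms (𝕜 := 𝕜) (EM := EM) (F := F) (E := E)
    have := hs.topologicalAddGroup
    let L : SmoothSection 𝕜 EM F E →ₗ[𝕜] SmoothSection 𝕜 EM F E :=
      { toFun := fun s => f • s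
        map_add' := smul_add f
        map_smul' := fun c s => ext fun x => smul_comm (f x) c (s x) }
    refine hs.continuous_of_continuous_comp L fun i =>
      continuous_of_le_continuous _ ?_ ?_ fun s => seminorms_smul_le f s i
    · exact continuous_finsetSum _ fun j _ => continuous_const.mul (hs.continuous_seminorm _)
    · simp
  continuous_smul_left s := by
    have hs := withSeminorms (𝕜 := 𝕜) (EM := EM) (F := F) (E := E)
    have hf := SmoothFn.withSeminorms (𝕜 := 𝕜) (EM := EM) (M := M)
    have := hs.topologicalAddGroup
    have := hf.topologicalAddGroup
    let L : SmoothFn 𝕜 EM M →ₗ[𝕜] SmoothSection 𝕜 EM F E :=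
      { toFun := fun f => f • s
        map_add' := fun f g => add_smul f g s
        map_smul' := fun c f => smul_assoc c f s }
    refine hs.continuous_of_continuous_comp L fun i =>
      continuous_of_le_continuous _ ?_ ?_ fun f => seminorms_smul_le f s i
    · exact continuous_finsetSum _ fun j _ =>
        (continuous_const.mul (hf.continuous_seminorm _)).mul continuous_const
    · simp

end SmoothSection

end Bundle

end

/-! ### Right inverses and transversality -/

/-! The module $\Gamma(M,E)$ has a finite dual basis: sections $t_j$ of $E$ and $s_j$ of $E^*$ with
$t=\sum_j (s_j\cdot t)\,t_j$ and $s=\sum_j (s\cdot t_j)\,s_j$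
(`SmoothSection.exists_finite_dualBasis`). The inverse of $\Phi$ is then $\ell\mapsto\sum_j
t_j\otimes\ell(s_j)$: moving the coefficients $s_j\cdot t$ across the tensor sign gives one
composite, linearity of $\ell$ the other. Continuity is formal. For $\Phi$ it is the universal
property of the inductive topology together with separate continuity of the contraction; for the
inverse, pointwise convergence already controls the finitely many values $\ell(s_j)$. This is
`exists_inductiveTensorOver_equiv_simpleHom`, which knows nothing of manifolds. The tensor product
inherits its locally convex module structure from the Hom space through $\Phi$.

Since $M$ need not be compact, finiteness of the spanning family is obtained by general position
(`SmoothSection.exists_span_eq_top`). Glue constant local sections with random coefficients into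
$N=\dim M+\dim_{\mathbb R}F+1$ global ones. They fail to span at $x$ only if a nonzero real
functional $l$ kills all of them, which is $N$ linear conditions on the coefficients against $\dim
M+\dim_{\mathbb R}F$ parameters $(x,l)$. By `measure_setOf_exists_apply_eq_zero` the bad
coefficients form a null set, locally and hence globally. The $s_j$ come from smooth local right
inverses of $v\mapsto\sum_j v_jt_j$, glued in `SmoothSection.exists_dualBasis`.

The contraction is estimated by the Leibniz rule, but only on compact sets over which the chosen
trivialization is defined; `SmoothFn.continuous_of_continuous_local` shows that these suffice, by
changing charts. -/

section Transversality

open MeasureTheory Module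

/-- Near a surjective linear map, right inverses can be chosen smoothly. -/
theorem exists_contDiffAt_rightInverse {𝕜 V Y : Type*} [RCLike 𝕜]
    [NormedAddCommGroup V] [NormedSpace ℝ V] [NormedSpace 𝕜 V] [IsScalarTower ℝ 𝕜 V]
    [NormedAddCommGroup Y] [NormedSpace ℝ Y] [NormedSpace 𝕜 Y] [IsScalarTower ℝ 𝕜 Y]
    [FiniteDimensional 𝕜 V] [FiniteDimensional 𝕜 Y]
    (T₀ : V →L[𝕜] Y) (hT₀ : Function.Surjective T₀) :
    ∃ S : (V →L[𝕜] Y) → (Y →L[𝕜] V),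
      ∀ᶠ T in 𝓝 T₀, ContDiffAt ℝ ∞ S T ∧ ∀ y, T (S T y) = y ∧ S T (T (S T₀ y)) = S T₀ y := by
  have := FiniteDimensional.complete 𝕜 Y
  obtain ⟨R₀, hR₀⟩ := (T₀ : V →ₗ[𝕜] Y).exists_rightInverse_of_surjective
    (LinearMap.range_eq_top.2 hT₀)
  let R : Y →L[𝕜] V := LinearMap.toContinuousLinearMap R₀
  have hR : T₀ ∘L R = 1 := by
    ext y
    exact LinearMap.congr_fun hR₀ y
  let Q : (V →L[𝕜] Y) → (Y →L[𝕜] Y) := fun T => T ∘L R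
  have hQ : ContDiff 𝕜 ∞ Q := ((ContinuousLinearMap.compL 𝕜 Y V Y).flip R).contDiff
  -- All these right inverses take values in the range of the fixed $R=S(T_0)$, so $S(T)\circ T$ is
  -- the identity on that range; this is the last claim.
  refine ⟨fun T => R ∘L Ring.inverse (Q T), ?_⟩
  have : ∀ᶠ A in 𝓝 (Q T₀), IsUnit A := Units.isOpen.mem_nhds (by simp [Q, hR])
  filter_upwards [hQ.continuous.continuousAt.eventually this] with T hT
  refine ⟨?_, fun y => ⟨DFunLike.congr_fun (Ring.mul_inverse_cancel _ hT) y, ?_⟩⟩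
  · have h₁ : ContDiffAt 𝕜 ∞ (Ring.inverse : (Y →L[𝕜] Y) → _) (Q T) :=
      contDiffAt_ringInverse 𝕜 hT.unit
    have h₂ : ContDiffAt 𝕜 ∞ (fun T => Ring.inverse (Q T)) T := h₁.comp T hQ.contDiffAt
    exact ((ContinuousLinearMap.compL 𝕜 Y Y V R).contDiff.contDiffAt.comp T h₂).restrict_scalars ℝ
  · have h₁ : Ring.inverse (Q T₀) = 1 := by simp [Q, hR]
    have h₂ := DFunLike.congr_fun (Ring.inverse_mul_cancel _ hT) y
    simp only [h₁]
    exact congrArg R h₂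

/-- Let `T` be a `C^1` family of surjective linear maps `V → ℝ^N`, with less than `N`
parameters. Almost no vector of `V` is in the kernel of some member of the family. -/
theorem measure_setOf_exists_apply_eq_zero {X V ι : Type*} [Fintype ι]
    [NormedAddCommGroup X] [NormedSpace ℝ X] [FiniteDimensional ℝ X]
    [NormedAddCommGroup V] [NormedSpace ℝ V] [FiniteDimensional ℝ V]
    [MeasurableSpace V] [BorelSpace V] (μ : Measure V) [μ.IsAddHaarMeasure]
    {D : Set X} (hD : IsOpen D) {T : X → V →L[ℝ] (ι → ℝ)} (hT : ContDiffOn ℝ 1 T D)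
    (hsurj : ∀ x ∈ D, Function.Surjective (T x)) (hdim : finrank ℝ X < Fintype.card ι) :
    μ {c | ∃ x ∈ D, T x c = 0} = 0 := by
  have key : ∀ x ∈ D, ∃ t ∈ 𝓝[D] x, μ {c | ∃ x ∈ t, T x c = 0} = 0 := by
    intro x₀ hx₀
    obtain ⟨S, hS'⟩ := exists_contDiffAt_rightInverse (T x₀) (hsurj x₀ hx₀)
    have hTx : ContDiffAt ℝ 1 T x₀ := hT.contDiffAt (hD.mem_nhds hx₀)
    let K := (T x₀ : V →ₗ[ℝ] ι → ℝ).ker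
    have hK : finrank ℝ K + Fintype.card ι = finrank ℝ V := by
      have h₁ := (T x₀ : V →ₗ[ℝ] ι → ℝ).finrank_range_add_finrank_ker
      rw [LinearMap.range_eq_top.2 (hsurj x₀ hx₀), finrank_top, finrank_fintype_fun_eq_card] at h₁
      exact (add_comm _ _).trans h₁
    have hSx : ContDiffAt ℝ 1 (fun x => S (T x)) x₀ :=
      (hS'.self_of_nhds.1.of_le (by exact_mod_cast le_top)).comp x₀ hTx
    obtain ⟨t, ht, htx⟩ := Filter.Eventually.exists_mem
      (((hTx.eventually (by simp)).and (hSx.eventually (by simp))).and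
        (hTx.continuousAt.eventually hS'))
    refine ⟨t, mem_nhdsWithin_of_mem_nhds ht, ?_⟩
    -- $1-S(T_x)T_x$ projects onto $\ker T_x$ and kills the range of $S(T_{x_0})$, a complement of
    -- $K=\ker T_{x_0}$. Hence $\Psi(x,\cdot)$ maps $K$ onto $\ker T_x$, and $\Psi$ parametrizes the
    -- union of the kernels.
    let Ψ : X × K → V := fun p => p.2 - S (T p.1) (T p.1 p.2)
    have hΨ : dimH (Ψ '' (t ×ˢ Set.univ)) ≤ dimH (t ×ˢ (Set.univ : Set K)) := by
      refine dimH_image_le_of_locally_lipschitzOn fun p hp => ?_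
      obtain ⟨⟨h₁, h₂⟩, -⟩ := htx p.1 hp.1
      have h₃ : ContDiffAt ℝ 1 (fun p : X × K => (p.2 : V)) p :=
        (K.subtypeL.contDiff.comp contDiff_snd).contDiffAt
      have hp : ContDiffAt ℝ 1 Ψ p :=
        h₃.sub ((h₂.comp p contDiffAt_fst).clm_apply ((h₁.comp p contDiffAt_fst).clm_apply h₃))
      obtain ⟨C, u, hu, h⟩ := hp.exists_lipschitzOnWith
      exact ⟨C, u, mem_nhdsWithin_of_mem_nhds hu, h⟩
    have hsub : {c | ∃ x ∈ t, T x c = 0} ⊆ Ψ '' (t ×ˢ Set.univ) := by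
      rintro c ⟨x, hx, hc⟩
      have h₀ : T x₀ (c - S (T x₀) (T x₀ c)) = 0 := by
        rw [map_sub, (hS'.self_of_nhds.2 _).1, sub_self]
      refine ⟨(x, ⟨c - S (T x₀) (T x₀ c), h₀⟩), ⟨hx, trivial⟩, ?_⟩
      simp [Ψ, hc, ((htx x hx).2.2 (T x₀ c)).2]
    -- Locally Lipschitz maps do not raise Hausdorff dimension, and $\dim(X\times K)=\dim X+\dim
    -- V-|\iota|<\dim V$.
    have hlt : dimH {c | ∃ x ∈ t, T x c = 0} < ((finrank ℝ V : NNReal) : ENNReal) := by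
      refine ((dimH_mono hsub).trans (hΨ.trans (dimH_mono (Set.subset_univ _)))).trans_lt ?_
      rw [Real.dimH_univ_eq_finrank, finrank_prod]
      norm_cast
      omega
    exact Measure.absolutelyContinuous_isAddHaarMeasure μ
      (Measure.hausdorffMeasure (finrank ℝ V)) (by simpa using hausdorffMeasure_of_dimH_lt hlt)
  choose! t ht ht₀ using key
  obtain ⟨s, hs, hsc, hst⟩ := TopologicalSpace.countable_cover_nhdsWithin ht
  refine measure_mono_null (t := ⋃ x ∈ s, {c | ∃ x' ∈ t x, T x' c = 0}) ?_
    ((measure_biUnion_null_iff hsc).2 fun x hx => ht₀ x (hs hx))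
  rintro c ⟨x, hx, hc⟩
  obtain ⟨y, hy, hxy⟩ := Set.mem_iUnion₂.1 (hst hx)
  exact Set.mem_iUnion₂.2 ⟨y, hy, x, hxy, hc⟩

end Transversality

/-! ### Gluing sections with partitions of unity -/

section Gluing

variable {𝕜 EM M F : Type*} {E : M → Type*} [RCLike 𝕜]
  [NormedAddCommGroup EM] [NormedSpace ℝ EM] [TopologicalSpace M] [ChartedSpace EM M]
  [NormedAddCommGroup F] [NormedSpace ℝ F] [NormedSpace 𝕜 F] [IsScalarTower ℝ 𝕜 F]
  [∀ x, AddCommGroup (E x)] [∀ x, Module 𝕜 (E x)] [∀ x, TopologicalSpace (E x)]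
  [TopologicalSpace (Bundle.TotalSpace F E)] [FiberBundle F E] [VectorBundle 𝕜 F E]

variable (EM F) in
/-- The family `u` of points of the fibres of `E` is smooth at `x₀`. -/
def SmoothSectionAt (u : Π x, E x) (x₀ : M) : Prop :=
  ContMDiffAt 𝓘(ℝ, EM) (𝓘(ℝ, EM).prod 𝓘(ℝ, F)) ∞ (fun x => Bundle.TotalSpace.mk' F x (u x)) x₀

namespace SmoothSectionAt

theorem congr {u v : Π x, E x} {x₀ : M} (hu : SmoothSectionAt EM F u x₀)
    (h : ∀ᶠ x in 𝓝 x₀, v x = u x) : SmoothSectionAt EM F v x₀ :=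
  ContMDiffAt.congr_of_eventuallyEq hu (h.mono fun x hx => by simp only [hx])

theorem sum_smul {ι : Type*} {s : Finset ι} {f : ι → M → 𝕜} {u : ι → Π x, E x} {x₀ : M}
    (hf : ∀ i ∈ s, ContMDiffAt 𝓘(ℝ, EM) 𝓘(ℝ, 𝕜) ∞ (f i) x₀)
    (hu : ∀ i ∈ s, SmoothSectionAt EM F (u i) x₀) :
    SmoothSectionAt EM F (fun x => ∑ i ∈ s, f i x • u i x) x₀ := by
  rw [SmoothSectionAt, Bundle.contMDiffAt_section]
  have : ContMDiffAt 𝓘(ℝ, EM) 𝓘(ℝ, F) ∞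
      (fun x => ∑ i ∈ s, f i x • (trivializationAt F E x₀ ⟨x, u i x⟩).2) x₀ := by
    refine ContMDiffAt.sum fun i hi => ?_
    have h := hu i hi
    rw [SmoothSectionAt, Bundle.contMDiffAt_section] at h
    exact ((ContinuousLinearMap.lsmul ℝ 𝕜 : 𝕜 →L[ℝ] F →L[ℝ] F).contMDiff.contMDiffAt.comp x₀
      (hf i hi)).clm_apply h
  refine this.congr_of_eventuallyEq ?_
  filter_upwards [(trivializationAt F E x₀).open_baseSet.mem_nhds
    (FiberBundle.mem_baseSet_trivializationAt' x₀)] with x hx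
  refine (map_sum (((trivializationAt F E x₀).linear 𝕜 hx).mk' _) _ s).trans ?_
  exact Finset.sum_congr rfl fun i _ => ((trivializationAt F E x₀).linear 𝕜 hx).map_smul _ _

/-- The local section of `E` which is constant in a local trivialization. -/
theorem trivialization_symm [SmoothVectorBundle 𝕜 EM F E]
    (e : Bundle.Trivialization F (Bundle.TotalSpace.proj : Bundle.TotalSpace F E → M))
    [MemTrivializationAtlas e] {x₀ : M} (hx₀ : x₀ ∈ e.baseSet) (v : F) :
    SmoothSectionAt EM F (fun x => e.symm x v) x₀ := by
  have hx₀' := FiberBundle.mem_baseSet_trivializationAt' (F := F) (E := E) x₀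
  have hU := (e.open_baseSet.inter (trivializationAt F E x₀).open_baseSet).mem_nhds ⟨hx₀, hx₀'⟩
  rw [SmoothSectionAt, Bundle.contMDiffAt_section]
  have hc := (SmoothVectorBundle.contMDiffOn_coordChangeL (𝕜 := 𝕜) (EM := EM)
    e (trivializationAt F E x₀)).contMDiffAt hU
  refine (((ContinuousLinearMap.restrictScalarsL 𝕜 F F ℝ ℝ).contMDiff.contMDiffAt.comp x₀
      hc).clm_apply (contMDiffAt_const (c := v))).congr_of_eventuallyEq ?_
  filter_upwards [hU] with x hx
  simp [Bundle.Trivialization.coordChangeL_apply _ _ hx, Bundle.Trivialization.mk_symm _ hx.1]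

end SmoothSectionAt

variable {ι : Type*}

variable (𝕜) in
/-- The sum of the local sections `u i`, weighted by a partition of unity. -/
noncomputable def SmoothPartitionOfUnity.glue (ρ : SmoothPartitionOfUnity ι 𝓘(ℝ, EM) M)
    (u : ι → Π x, E x) (x : M) : E x := ∑ᶠ i, ((ρ i x : ℝ) : 𝕜) • u i x

theorem SmoothPartitionOfUnity.glue_eq_sum (ρ : SmoothPartitionOfUnity ι 𝓘(ℝ, EM) M)
    (u : ι → Π x, E x) {x : M} {S : Finset ι} (hS : ρ.finsupport x ⊆ S) :
    ρ.glue 𝕜 u x = ∑ i ∈ S, ((ρ i x : ℝ) : 𝕜) • u i x := by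
  refine finsum_eq_sum_of_support_subset _ fun i hi => hS ?_
  rw [ρ.mem_finsupport]
  intro h
  refine hi ?_
  simp [h]

/-- Near $x_0$ the glued section is a sum over the fixed finite set of indices whose closed support
contains $x_0$, so each local section only has to be smooth on the closed support of its weight. -/
theorem SmoothPartitionOfUnity.smoothSectionAt_glue (ρ : SmoothPartitionOfUnity ι 𝓘(ℝ, EM) M)
    {u : ι → Π x, E x} (hu : ∀ i, ∀ x ∈ tsupport (ρ i), SmoothSectionAt EM F (u i) x) (x₀ : M) :
    SmoothSectionAt EM F (ρ.glue 𝕜 u) x₀ := by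
  refine SmoothSectionAt.congr (SmoothSectionAt.sum_smul (s := ρ.fintsupport x₀) (fun i _ => ?_)
    fun i hi => hu i x₀ ((ρ.mem_fintsupport_iff x₀ i).1 hi)) 
    ((ρ.eventually_finsupport_subset x₀).mono fun x => ρ.glue_eq_sum u)
  exact (RCLike.ofRealCLM (K := 𝕜)).contMDiff.contMDiffAt.comp x₀ (ρ i).contMDiff.contMDiffAt

theorem SmoothPartitionOfUnity.sum_fintsupport (ρ : SmoothPartitionOfUnity ι 𝓘(ℝ, EM) M) (x : M) :
    ∑ i ∈ ρ.fintsupport x, ρ i x = 1 :=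
  ρ.sum_finsupport' x (Set.mem_univ x) (ρ.finsupport_subset_fintsupport x)

end Gluing

/-! ### Finitely many sections spanning all fibres -/

section Generic

open MeasureTheory Module

/-- Vectors fail to span exactly when a nonzero functional $l$ kills them all. So the transversality
lemma applies with parameters $(y,l)$, $l\neq0$, and one equation for each vector. The functionals
are not normalized, whence the full $\dim F$ in the dimension bound. -/
theorem measure_setOf_exists_span_ne_top {X F J κ : Type*} [Fintype J] [Fintype κ]
    [NormedAddCommGroup X] [NormedSpace ℝ X] [FiniteDimensional ℝ X]
    [NormedAddCommGroup F] [NormedSpace ℝ F] [FiniteDimensional ℝ F]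
    [MeasurableSpace F] [BorelSpace F] (μ : Measure (J → κ → F)) [μ.IsAddHaarMeasure]
    {U : Set X} (hU : IsOpen U) {G : J → X → F →L[ℝ] F} (hG : ∀ i, ContDiffOn ℝ 1 (G i) U)
    (hsurj : ∀ y ∈ U, ∃ i, Function.Surjective (G i y))
    (hdim : finrank ℝ X + finrank ℝ F < Fintype.card κ) :
    μ {c | ∃ y ∈ U, Submodule.span ℝ (Set.range fun j => ∑ i, G i y (c i j)) ≠ ⊤} = 0 := by
  classical
  let D : Set (X × (F →L[ℝ] ℝ)) := U ×ˢ {0}ᶜ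
  have hD : IsOpen D := hU.prod isOpen_compl_singleton
  let T : X × (F →L[ℝ] ℝ) → (J → κ → F) →L[ℝ] (κ → ℝ) := fun p =>
    ContinuousLinearMap.pi fun j => ∑ i, (p.2 ∘L G i p.1) ∘L
      (ContinuousLinearMap.proj j ∘L ContinuousLinearMap.proj (R := ℝ) (φ := fun _ : J => κ → F) i)
  have hTa (p c j) : T p c j = ∑ i, p.2 (G i p.1 (c i j)) := by simp [T]
  have hT : ContDiffOn ℝ 1 T D := by
    refine contDiffOn_clm_apply.2 fun c => contDiffOn_pi.2 fun j => ?_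
    simp only [hTa]
    refine ContDiffOn.sum fun i _ => ?_
    exact contDiffOn_snd.clm_apply
      (((hG i).comp contDiffOn_fst fun p hp => hp.1).clm_apply contDiffOn_const)
  have hTs : ∀ p ∈ D, Function.Surjective (T p) := by
    rintro ⟨y, l⟩ ⟨hy, hl⟩ a
    obtain ⟨i, hi⟩ := hsurj y hy
    obtain ⟨v, hv⟩ : ∃ v, l v ≠ 0 := by
      by_contra! h
      exact hl (ContinuousLinearMap.ext h)
    obtain ⟨w, hw⟩ := hi v
    -- The block of coefficients with the surjective $G_i(y)$ alone reaches every target $a$,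
    -- because $l(G_i(y)w)=l(v)\neq0$.
    refine ⟨Pi.single i fun j => (a j / l v) • w, funext fun j => ?_⟩
    rw [hTa, Finset.sum_eq_single i]
    · simp [hw, hv]
    · intro k _ hk
      simp [hk]
    · simp
  refine measure_mono_null ?_ (measure_setOf_exists_apply_eq_zero μ hD hT hTs ?_)
  · rintro c ⟨y, hy, hc⟩
    obtain ⟨l, hl, hlc⟩ := Submodule.exists_le_ker_of_lt_top _ (lt_top_iff_ne_top.2 hc)
    refine ⟨(y, LinearMap.toContinuousLinearMap l), ⟨hy, by simpa using hl⟩, funext fun j => ?_⟩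
    have := hlc (Submodule.subset_span ⟨j, rfl⟩)
    simpa [hTa] using this
  · rw [finrank_prod]
    have : finrank ℝ (F →L[ℝ] ℝ) = finrank ℝ F := by
      rw [← LinearEquiv.finrank_eq (LinearMap.toContinuousLinearMap (𝕜 := ℝ) (E := F) (F' := ℝ))]
      exact Subspace.dual_finrank_eq
    omega

/-- Stands in for Lebesgue measure when there are infinitely many coordinates: take the product of
copies of Haar measure restricted to a compact set of measure one. Its finite marginals are
absolutely continuous with respect to Haar measure, so null conditions on finitely many coordinates
remain null. -/
theorem exists_isProbabilityMeasure_pi (I V : Type*) [NormedAddCommGroup V] [NormedSpace ℝ V]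
    [FiniteDimensional ℝ V] [MeasurableSpace V] [BorelSpace V] :
    ∃ P : Measure (I → V), IsProbabilityMeasure P ∧ ∀ (S : Finset I) (B : Set (S → V)),
      (Measure.pi fun _ : S => (Measure.addHaar : Measure V)) B = 0 → P (S.restrict ⁻¹' B) = 0 := by
  let K : TopologicalSpace.PositiveCompacts V := Classical.arbitrary _
  let μ : Measure V := (Measure.addHaarMeasure K).restrict K
  have : IsProbabilityMeasure μ := ⟨by simp [μ, Measure.addHaarMeasure_self]⟩
  refine ⟨Measure.infinitePi fun _ => μ, inferInstance, fun S B hB => ?_⟩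
  have h₁ : (Measure.pi fun _ : S => μ) B = 0 := by
    refine Measure.AbsolutelyContinuous.trans (Measure.absolutelyContinuous_of_le ?_)
      (Measure.absolutelyContinuous_isAddHaarMeasure
        (Measure.pi fun _ : S => Measure.addHaarMeasure K) _) hB
    rw [← Measure.restrict_pi_pi]
    exact Measure.restrict_le_self
  rw [← Measure.infinitePi_map_restrict (μ := fun _ => μ)] at h₁
  exact Measure.preimage_null_of_map_null (Finset.measurable_restrict S).aemeasurable h₁

end Generic

/-! ### Spanning sections from generic coefficients -/

section Spanning

open MeasureTheory Module

variable {𝕜 EM M F : Type*} {E : M → Type*} [RCLike 𝕜]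
  [NormedAddCommGroup EM] [NormedSpace ℝ EM] [TopologicalSpace M] [ChartedSpace EM M]
  [NormedAddCommGroup F] [NormedSpace ℝ F] [NormedSpace 𝕜 F] [IsScalarTower ℝ 𝕜 F]
  [∀ x, AddCommGroup (E x)] [∀ x, Module 𝕜 (E x)] [∀ x, TopologicalSpace (E x)]
  [TopologicalSpace (Bundle.TotalSpace F E)] [FiberBundle F E] [VectorBundle 𝕜 F E]

/-- The fibres of a smooth vector bundle are spanned by finitely many smooth sections. -/
theorem SmoothSection.exists_span_eq_top [FiniteDimensional ℝ EM] [IsManifold 𝓘(ℝ, EM) ∞ M]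
    [T2Space M] [SecondCountableTopology M] [FiniteDimensional 𝕜 F]
    [SmoothVectorBundle 𝕜 EM F E] :
    ∃ (N : ℕ) (t : Fin N → SmoothSection 𝕜 EM F E),
      ∀ x, Submodule.span 𝕜 (Set.range fun j => t j x) = ⊤ := by
  have : FiniteDimensional ℝ F := FiniteDimensional.trans ℝ 𝕜 F
  have : LocallyCompactSpace M := ChartedSpace.locallyCompactSpace EM M
  borelize F
  -- One more than the number of real parameters: a point of $M$ and a real functional on $F$.
  let N := finrank ℝ EM + finrank ℝ F + 1
  let e (x : M) := trivializationAt F E x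
  have he (x : M) : x ∈ (e x).baseSet := FiberBundle.mem_baseSet_trivializationAt' x
  obtain ⟨ρ, hρ⟩ := SmoothPartitionOfUnity.exists_isSubordinate 𝓘(ℝ, EM) isClosed_univ
    (fun x => (e x).baseSet) (fun x => (e x).open_baseSet)
    fun x _ => Set.mem_iUnion.2 ⟨x, he x⟩
  -- The partition of unity is indexed by all points of $M$, so `c` lives in an infinite product;
  -- near a given point only finitely many of its coordinates matter.
  let t (c : M → Fin N → F) (j : Fin N) : SmoothSection 𝕜 EM F E :=
    ⟨ρ.glue 𝕜 fun i x => (e i).symm x (c i j), ρ.smoothSectionAt_glue fun i x hx =>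
      SmoothSectionAt.trivialization_symm (𝕜 := 𝕜) (e i) (hρ i hx) _⟩
  obtain ⟨P, hP, hP₀⟩ := exists_isProbabilityMeasure_pi M (Fin N → F)
  have key (x₀ : M) : ∃ O ∈ 𝓝 x₀,
      P {c | ∃ x ∈ O, Submodule.span 𝕜 (Set.range fun j => t c j x) ≠ ⊤} = 0 := by
    let S := ρ.fintsupport x₀
    let φ := chartAt EM x₀
    obtain ⟨O, hO, hOo, hxO⟩ : ∃ O : Set M, (∀ x ∈ O, (ρ.finsupport x ⊆ S ∧ x ∈ (e x₀).baseSet ∧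
        x ∈ φ.source) ∧ ∀ i ∈ S, x ∈ (e i).baseSet) ∧ IsOpen O ∧ x₀ ∈ O := by
      refine eventually_nhds_iff.1 (((ρ.eventually_finsupport_subset x₀).and
        (((e x₀).open_baseSet.eventually_mem (he x₀)).and
          (φ.open_source.eventually_mem (mem_chart_source EM x₀)))).and
          ((Filter.eventually_all_finset S).2 fun i hi => (e i).open_baseSet.eventually_mem
            (hρ i ((ρ.mem_fintsupport_iff x₀ i).1 hi))))
    refine ⟨O, hOo.mem_nhds hxO, ?_⟩
    let U : Set EM := φ.target ∩ φ.symm ⁻¹' O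
    have hU : IsOpen U := φ.isOpen_inter_preimage_symm hOo
    -- The contribution of index `i` as seen in the trivialization at `x₀`: a weight times an
    -- isomorphism, hence surjective wherever the weight is nonzero. The weights sum to one, so some
    -- weight is.
    let G (i : S) (y : EM) : F →L[ℝ] F := ρ i (φ.symm y) •
      ((e i).coordChangeL 𝕜 (e x₀) (φ.symm y) : F →L[𝕜] F).restrictScalars ℝ
    have hG (i : S) : ContDiffOn ℝ 1 (G i) U := by
      have h₁ : ContMDiffOn 𝓘(ℝ, EM) 𝓘(ℝ, F →L[ℝ] F) ∞ (fun x => ρ i x •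
          ((e i).coordChangeL 𝕜 (e x₀) x : F →L[𝕜] F).restrictScalars ℝ) O := by
        refine (ρ i).contMDiff.contMDiffOn.smul ?_
        refine (ContinuousLinearMap.restrictScalarsL 𝕜 F F ℝ ℝ).contMDiff.comp_contMDiffOn
          ((SmoothVectorBundle.contMDiffOn_coordChangeL (e i) (e x₀)).mono fun x hx => ?_)
        exact ⟨(hO x hx).2 i i.2, (hO x hx).1.2.1⟩
      have h₂ := h₁.comp (contMDiffOn_chart_symm.mono Set.inter_subset_left)
        fun y (hy : y ∈ U) => hy.2
      exact (contMDiffOn_iff_contDiffOn.1 h₂).of_le (by exact_mod_cast le_top)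
    have hsum (x) (hx : x ∈ O) : ∑ i ∈ S, ρ i x = 1 :=
      ρ.sum_finsupport' x (Set.mem_univ x) (hO x hx).1.1
    have hsurj (y) (hy : y ∈ U) : ∃ i, Function.Surjective (G i y) := by
      obtain ⟨i, hi, hi'⟩ := Finset.exists_ne_zero_of_sum_ne_zero
        ((hsum _ hy.2).trans_ne one_ne_zero)
      refine ⟨⟨i, hi⟩, fun v => ?_⟩
      refine ⟨((e i).coordChangeL 𝕜 (e x₀) (φ.symm y)).symm ((ρ i (φ.symm y))⁻¹ • v), ?_⟩
      simp [G, hi']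
    refine measure_mono_null ?_ (hP₀ S _ (measure_setOf_exists_span_ne_top _ hU hG hsurj
      (by simp [N])))
    rintro c ⟨x, hx, hc⟩
    have hxφ := φ.left_inv (hO x hx).1.2.2
    refine ⟨φ x, ⟨φ.map_source (hO x hx).1.2.2, ?_⟩, fun htop => hc ?_⟩
    · rwa [Set.mem_preimage, hxφ]
    · let L := (e x₀).linearEquivAt 𝕜 x (hO x hx).1.2.1
      have hL (j : Fin N) : L (t c j x) = ∑ i, G i (φ x) (S.restrict c i j) := by
        have ht : t c j x = ∑ i ∈ S, ((ρ i x : ℝ) : 𝕜) • (e i).symm x (c i j) :=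
          ρ.glue_eq_sum (fun i x => (e i).symm x (c i j)) (hO x hx).1.1
        rw [ht, map_sum, ← Finset.sum_coe_sort S]
        refine Finset.sum_congr rfl fun i _ => ?_
        change L (_ • _) = ρ i (φ.symm (φ x)) • (e i).coordChangeL 𝕜 (e x₀) (φ.symm (φ x)) (c i j)
        rw [hxφ, map_smul, RCLike.real_smul_eq_coe_smul (K := 𝕜),
          Bundle.Trivialization.coordChangeL_apply _ _ ⟨(hO x hx).2 i i.2, (hO x hx).1.2.1⟩]
        rfl
      simp only [← hL] at htop
      refine eq_top_iff.2 fun v _ => ?_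
      -- The measure argument gives the real span, which lies in the span over `𝕜`.
      have h₁ : L v ∈ Submodule.span 𝕜 (Set.range fun j => L (t c j x)) :=
        Submodule.span_le_restrictScalars ℝ 𝕜 _ (htop ▸ Submodule.mem_top)
      have h₂ : (Set.range fun j => L (t c j x)) = L '' Set.range fun j => t c j x :=
        Set.range_comp L _
      rw [h₂, ← LinearEquiv.coe_coe, ← Submodule.map_span] at h₁
      obtain ⟨w, hw, hwv⟩ := h₁
      rwa [← L.injective hwv]
  choose O hO hPO using key
  obtain ⟨s, hs, hsO⟩ := TopologicalSpace.countable_cover_nhds hO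
  have hnull : P (⋃ x₀ ∈ s, {c | ∃ x ∈ O x₀,
      Submodule.span 𝕜 (Set.range fun j => t c j x) ≠ ⊤}) = 0 :=
    (measure_biUnion_null_iff hs).2 fun x₀ _ => hPO x₀
  -- A countable union of null sets cannot exhaust a probability space, so one choice of
  -- coefficients works at all points of $M$.
  obtain ⟨c, hc⟩ : ∃ c, c ∉ ⋃ x₀ ∈ s, {c | ∃ x ∈ O x₀,
      Submodule.span 𝕜 (Set.range fun j => t c j x) ≠ ⊤} := by
    by_contra! h
    rw [Set.eq_univ_of_forall h, measure_univ] at hnull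
    exact one_ne_zero hnull
  refine ⟨N, t c, fun x => ?_⟩
  by_contra h
  obtain ⟨x₀, hx₀, hx⟩ := Set.mem_iUnion₂.1 (hsO ▸ Set.mem_univ x)
  exact hc (Set.mem_iUnion₂.2 ⟨x₀, hx₀, x, hx, h⟩)

end Spanning

/-! ### Dual bases -/

section DualBasis

variable {𝕜 EM M F : Type*} {E : M → Type*} [RCLike 𝕜]
  [NormedAddCommGroup EM] [NormedSpace ℝ EM] [TopologicalSpace M] [ChartedSpace EM M]
  [NormedAddCommGroup F] [NormedSpace ℝ F] [NormedSpace 𝕜 F] [IsScalarTower ℝ 𝕜 F]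
  [∀ x, AddCommGroup (E x)] [∀ x, Module 𝕜 (E x)] [∀ x, TopologicalSpace (E x)]
  [TopologicalSpace (Bundle.TotalSpace F E)] [FiberBundle F E] [VectorBundle 𝕜 F E]

/-- The trivialization of a Hom bundle conjugates by those of source and target; here the target is
a trivial line bundle and contributes the identity. -/
theorem DualBundle.trivializationAt_apply (x₀ : M) {x : M} (l : DualBundle 𝕜 E x) :
    (trivializationAt (F →L[𝕜] 𝕜) (DualBundle 𝕜 E) x₀ ⟨x, l⟩).2 =
      (l : E x →L[𝕜] 𝕜) ∘L (trivializationAt F E x₀).symmL 𝕜 x := by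
  rw [hom_trivializationAt_apply]
  ext v
  change ContinuousLinearMap.inCoordinates F E 𝕜 (Bundle.Trivial M 𝕜) x₀ x x₀ x l v = _
  rw [ContinuousLinearMap.inCoordinates, ContinuousLinearMap.comp_apply,
    ContinuousLinearMap.comp_apply]
  exact DFunLike.congr_fun (Bundle.Trivial.continuousLinearMapAt_trivialization 𝕜 M 𝕜 x) _

theorem SmoothSectionAt.dual {u : Π x, E x →L[𝕜] 𝕜} {x₀ : M}
    (hu : ContMDiffAt 𝓘(ℝ, EM) 𝓘(ℝ, F →L[𝕜] 𝕜) ∞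
      (fun x => u x ∘L (trivializationAt F E x₀).symmL 𝕜 x) x₀) :
    SmoothSectionAt EM (F →L[𝕜] 𝕜) (E := DualBundle 𝕜 E) u x₀ := by
  rw [SmoothSectionAt, Bundle.contMDiffAt_section]
  simpa only [DualBundle.trivializationAt_apply] using hu

variable [SmoothVectorBundle 𝕜 EM F E]

theorem SmoothSection.sum_apply {ι : Type*} (S : Finset ι) (s : ι → SmoothSection 𝕜 EM F E)
    (x : M) : (∑ i ∈ S, s i) x = ∑ i ∈ S, s i x :=
  map_sum (⟨⟨fun s => s x, rfl⟩, fun _ _ => rfl⟩ : SmoothSection 𝕜 EM F E →+ E x) s S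

/-- Smoothness at a point is tested in the preferred trivialization there; the smooth coordinate
change carries it to any other trivialization of the atlas. -/
theorem SmoothSection.contMDiffAt_trivialization (s : SmoothSection 𝕜 EM F E)
    (e : Bundle.Trivialization F (Bundle.TotalSpace.proj : Bundle.TotalSpace F E → M))
    [MemTrivializationAtlas e] {x₀ : M} (hx₀ : x₀ ∈ e.baseSet) :
    ContMDiffAt 𝓘(ℝ, EM) 𝓘(ℝ, F) ∞ (fun x => (e ⟨x, s x⟩).2) x₀ := by
  have hs := s.contMDiff x₀
  rw [Bundle.contMDiffAt_section] at hs
  have hU := ((trivializationAt F E x₀).open_baseSet.inter e.open_baseSet).mem_nhds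
    ⟨FiberBundle.mem_baseSet_trivializationAt' (F := F) (E := E) x₀, hx₀⟩
  have hc := (SmoothVectorBundle.contMDiffOn_coordChangeL (𝕜 := 𝕜) (EM := EM)
    (trivializationAt F E x₀) e).contMDiffAt hU
  refine (((ContinuousLinearMap.restrictScalarsL 𝕜 F F ℝ ℝ).contMDiff.contMDiffAt.comp x₀
    hc).clm_apply hs).congr_of_eventuallyEq ?_
  filter_upwards [hU] with x hx
  simp [Bundle.Trivialization.coordChangeL_apply _ _ hx,
    Bundle.Trivialization.symm_apply_apply_mk _ hx.1]

/-- Finitely many sections of `E` spanning the fibres can be complemented to a dual basis. -/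
theorem SmoothSection.exists_dualBasis [FiniteDimensional ℝ EM] [IsManifold 𝓘(ℝ, EM) ∞ M]
    [T2Space M] [SecondCountableTopology M] [FiniteDimensional 𝕜 F] {ι : Type*} [Fintype ι]
    (t : ι → SmoothSection 𝕜 EM F E)
    (ht : ∀ x, Submodule.span 𝕜 (Set.range fun j => t j x) = ⊤) :
    ∃ s : ι → SmoothSection 𝕜 EM (F →L[𝕜] 𝕜) (DualBundle 𝕜 E),
      ∀ x (v : E x), ∑ j, (s j x v : 𝕜) • t j x = v := by
  have : LocallyCompactSpace M := ChartedSpace.locallyCompactSpace EM M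
  let e (x : M) := trivializationAt F E x
  have he (x : M) : x ∈ (e x).baseSet := FiberBundle.mem_baseSet_trivializationAt' x
  -- The map $v\mapsto\sum_j v_jt_j(x)$ read in the trivialization at `x₀`. The components of a
  -- smooth right inverse of it are the local dual sections.
  let A (x₀ x : M) : (ι → 𝕜) →L[𝕜] F := ∑ j,
    (ContinuousLinearMap.proj (R := 𝕜) (φ := fun _ : ι => 𝕜) j).smulRight (e x₀ ⟨x, t j x⟩).2
  have hA (x₀) {x} (hx : x ∈ (e x₀).baseSet) (v : ι → 𝕜) :
      A x₀ x v = (e x₀).linearEquivAt 𝕜 x hx (∑ j, v j • t j x) := by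
    simp [A, map_sum]
  have hAs (x₀) : Function.Surjective (A x₀ x₀) := by
    intro w
    obtain ⟨v, rfl⟩ := ((e x₀).linearEquivAt 𝕜 x₀ (he x₀)).surjective w
    have hv : v ∈ Submodule.span 𝕜 (Set.range fun j => t j x₀) := ht x₀ ▸ Submodule.mem_top
    obtain ⟨c, rfl⟩ := (Submodule.mem_span_range_iff_exists_fun 𝕜).1 hv
    exact ⟨c, hA x₀ (he x₀) c⟩
  have hAc (x₀) {x} (hx : x ∈ (e x₀).baseSet) :
      ContMDiffAt 𝓘(ℝ, EM) 𝓘(ℝ, (ι → 𝕜) →L[𝕜] F) ∞ (A x₀) x := by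
    refine ContMDiffAt.sum fun j _ => ?_
    have h : ContDiff 𝕜 ∞ (ContinuousLinearMap.smulRightL 𝕜 (ι → 𝕜) F
      (ContinuousLinearMap.proj j)) := ContinuousLinearMap.contDiff _
    exact (h.restrict_scalars ℝ).contMDiff.contMDiffAt.comp x
      ((t j).contMDiffAt_trivialization (e x₀) hx)
  choose R hR using fun x₀ => exists_contDiffAt_rightInverse (A x₀ x₀) (hAs x₀)
  have hO (x₀) : ∃ O : Set M, (∀ x ∈ O, (ContDiffAt ℝ ∞ (R x₀) (A x₀ x) ∧
      ∀ w, A x₀ x (R x₀ (A x₀ x) w) = w) ∧ x ∈ (e x₀).baseSet) ∧ IsOpen O ∧ x₀ ∈ O := by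
    refine eventually_nhds_iff.1 (Filter.Eventually.and ?_
      ((e x₀).open_baseSet.eventually_mem (he x₀)))
    filter_upwards [(hAc x₀ (he x₀)).continuousAt.eventually (hR x₀)] with x hx
    exact ⟨hx.1, fun w => (hx.2 w).1⟩
  choose O hO hOo hxO using hO
  obtain ⟨ρ, hρ⟩ := SmoothPartitionOfUnity.exists_isSubordinate 𝓘(ℝ, EM) isClosed_univ
    O hOo fun x _ => Set.mem_iUnion.2 ⟨x, hxO x⟩
  let u (j : ι) (x₀ x : M) : DualBundle 𝕜 E x :=
    ((ContinuousLinearMap.proj (R := 𝕜) (φ := fun _ : ι => 𝕜) j ∘L R x₀ (A x₀ x)) ∘L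
      (e x₀).continuousLinearMapAt 𝕜 x : E x →L[𝕜] 𝕜)
  have hu (j x₀ x₁) (hx₁ : x₁ ∈ O x₀) : SmoothSectionAt EM (F →L[𝕜] 𝕜) (u j x₀) x₁ := by
    refine SmoothSectionAt.dual ?_
    have hU := ((e x₁).open_baseSet.inter (e x₀).open_baseSet).mem_nhds ⟨he x₁, (hO x₀ x₁ hx₁).2⟩
    have hc := (SmoothVectorBundle.contMDiffOn_coordChangeL (𝕜 := 𝕜) (EM := EM)
      (e x₁) (e x₀)).contMDiffAt hU
    have h₁ : ContMDiffAt 𝓘(ℝ, EM) 𝓘(ℝ, F →L[𝕜] (ι → 𝕜)) ∞ (fun x => R x₀ (A x₀ x)) x₁ :=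
      ((hO x₀ x₁ hx₁).1.1.contMDiffAt).comp x₁ (hAc x₀ (hO x₀ x₁ hx₁).2)
    -- Read at `x₁`, the local dual section is the right inverse composed with the coordinate change
    -- from `e x₁` to `e x₀`; both factors vary smoothly.
    have hB : ContDiff 𝕜 ∞ fun p : (F →L[𝕜] (ι → 𝕜)) × (F →L[𝕜] F) =>
        (ContinuousLinearMap.proj (R := 𝕜) (φ := fun _ : ι => 𝕜) j ∘L p.1) ∘L p.2 :=
      (contDiff_const.clm_comp contDiff_fst).clm_comp contDiff_snd
    refine ((hB.restrict_scalars ℝ).contMDiff.contMDiffAt.comp x₁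
      (h₁.prodMk_space hc)).congr_of_eventuallyEq ?_
    filter_upwards [hU] with x hx
    ext v
    change R x₀ (A x₀ x) ((e x₀).continuousLinearMapAt 𝕜 x ((e x₁).symmL 𝕜 x v)) j =
      R x₀ (A x₀ x) ((e x₁).coordChangeL 𝕜 (e x₀) x v) j
    rw [Bundle.Trivialization.coordChangeL_apply _ _ hx,
      Bundle.Trivialization.continuousLinearMapAt_apply_of_mem _ _ hx.2,
      Bundle.Trivialization.symmL_apply _ hx.1]
  have hut (x₀ x) (hx : x ∈ O x₀) (v : E x) : ∑ j, (u j x₀ x v : 𝕜) • t j x = v := by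
    refine ((e x₀).linearEquivAt 𝕜 x (hO x₀ x hx).2).injective ?_
    refine (hA x₀ (hO x₀ x hx).2 _).symm.trans (((hO x₀ x hx).1.2 _).trans ?_)
    exact (e x₀).continuousLinearMapAt_apply_of_mem 𝕜 (hO x₀ x hx).2 v
  refine ⟨fun j => ⟨ρ.glue 𝕜 (u j), ρ.smoothSectionAt_glue fun i x hx => hu j i x (hρ i hx)⟩,
    fun x v => ?_⟩
  have hs (j) : (ρ.glue 𝕜 (u j) x v : 𝕜) =
      ∑ i ∈ ρ.fintsupport x, ((ρ i x : ℝ) : 𝕜) * u j i x v := by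
    rw [ρ.glue_eq_sum (u j) (ρ.finsupport_subset_fintsupport x)]
    refine (_root_.sum_apply _ _ _).trans ?_
    rfl
  -- For fixed $t_j$ the identity $\sum_j u_j(v)t_j=v$ is affine in $(u_j)$, so it survives
  -- averaging with weights of sum one.
  simp only [hs, Finset.sum_smul, mul_smul]
  rw [Finset.sum_comm]
  simp only [← Finset.smul_sum]
  rw [Finset.sum_congr rfl fun i hi => by
    rw [hut i x (hρ i ((ρ.mem_fintsupport_iff x i).1 hi)) v], ← Finset.sum_smul,
    ← RCLike.ofReal_sum, ρ.sum_fintsupport x, RCLike.ofReal_one, one_smul]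

variable (𝕜 EM F E) in
/-- The module of sections of `E` has a finite dual basis. -/
theorem SmoothSection.exists_finite_dualBasis [FiniteDimensional ℝ EM] [IsManifold 𝓘(ℝ, EM) ∞ M]
    [T2Space M] [SecondCountableTopology M] [FiniteDimensional 𝕜 F] :
    ∃ (N : ℕ) (t : Fin N → SmoothSection 𝕜 EM F E)
      (s : Fin N → SmoothSection 𝕜 EM (F →L[𝕜] 𝕜) (DualBundle 𝕜 E)),
      (∀ t', ∑ j, contraction (s j) t' • t j = t') ∧
      (∀ s', ∑ j, contraction s' (t j) • s j = s') := by
  obtain ⟨N, t, ht⟩ := SmoothSection.exists_span_eq_top (𝕜 := 𝕜) (EM := EM) (F := F) (E := E)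
  obtain ⟨s, hs⟩ := SmoothSection.exists_dualBasis t ht
  refine ⟨N, t, s, fun t' => SmoothSection.ext fun x => ?_, fun s' => SmoothSection.ext fun x => ?_⟩
  · rw [SmoothSection.sum_apply]
    exact hs x (t' x)
  · rw [SmoothSection.sum_apply]
    ext v
    refine (_root_.sum_apply _ _ _).trans ?_
    -- The expansion of `s'` is the transpose of that of `v`: apply `s' x` to $v=\sum_j s_j(v)t_j$.
    conv_rhs => rw [← hs x v, map_sum]
    refine Finset.sum_congr rfl fun j _ => ?_
    rw [map_smul]
    exact mul_comm _ _

end DualBasis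

/-! ### Continuity of the contraction -/

section Contraction

variable {𝕜 EM M F : Type*} {E : M → Type*} [RCLike 𝕜]
  [NormedAddCommGroup EM] [NormedSpace ℝ EM] [TopologicalSpace M] [ChartedSpace EM M]
  [NormedAddCommGroup F] [NormedSpace ℝ F] [NormedSpace 𝕜 F] [IsScalarTower ℝ 𝕜 F]
  [∀ x, AddCommGroup (E x)] [∀ x, Module 𝕜 (E x)] [∀ x, TopologicalSpace (E x)]
  [TopologicalSpace (Bundle.TotalSpace F E)] [FiberBundle F E] [VectorBundle 𝕜 F E]
  [IsManifold 𝓘(ℝ, EM) ∞ M]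

/-- Locally, the derivatives of a function in one chart are bounded by its derivatives in another
chart. -/
theorem SmoothFn.exists_norm_iteratedFDerivWithin_le [FiniteDimensional ℝ EM] (p : M) (k : ℕ)
    {y₀ : EM} (hy₀ : y₀ ∈ (chartAt EM p).target) {O : Set M} (hO : IsOpen O)
    (hyO : (chartAt EM p).symm y₀ ∈ O) :
    ∃ K₀ ∈ 𝓝 y₀, ∃ i : ℕ → FnIndex EM M,
      (∀ j, (i j).pt = (chartAt EM p).symm y₀ ∧ Set.MapsTo (chartAt EM (i j).pt).symm (i j).K O) ∧
      ∃ C : ℝ, 0 ≤ C ∧ ∀ f : SmoothFn 𝕜 EM M, ∀ y ∈ K₀,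
        ‖iteratedFDerivWithin ℝ k (localRep p f) (chartAt EM p).target y‖ ≤
          C * ∑ j ∈ Finset.range (k + 1), seminorms 𝕜 EM M (i j) f := by
  set φ := chartAt EM p
  set q := φ.symm y₀
  set χ := chartAt EM q
  let ψ : EM → EM := χ ∘ φ.symm
  let W : Set EM := φ.target ∩ φ.symm ⁻¹' (χ.source ∩ O)
  have hW : IsOpen W := φ.isOpen_inter_preimage_symm (χ.open_source.inter hO)
  have hψ : ContDiffOn ℝ ∞ ψ W := by
    rw [← contMDiffOn_iff_contDiffOn]
    exact contMDiffOn_chart.comp (contMDiffOn_chart_symm.mono Set.inter_subset_left)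
      fun y hy => hy.2.1
  obtain ⟨K₀, hK₀, hyK₀, hK₀W⟩ := exists_compact_subset hW
    (⟨hy₀, mem_chart_source EM q, hyO⟩ : y₀ ∈ W)
  have hK₁ : IsCompact (ψ '' K₀) := hK₀.image_of_continuousOn (hψ.continuousOn.mono hK₀W)
  have hK₁' : ψ '' K₀ ⊆ χ.target := by
    rintro _ ⟨y, hy, rfl⟩
    exact χ.map_source (hK₀W hy).2.1
  refine ⟨K₀, mem_interior_iff_mem_nhds.1 hyK₀, fun j => ⟨q, ψ '' K₀, hK₁, hK₁', j⟩,
    fun j => ⟨rfl, ?_⟩, ?_⟩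
  · rintro _ ⟨y, hy, rfl⟩
    change χ.symm (χ (φ.symm y)) ∈ O
    rw [χ.left_inv (hK₀W hy).2.1]
    exact (hK₀W hy).2.2
  have hD (j : ℕ) : ∃ D, ∀ y ∈ K₀, ‖iteratedFDerivWithin ℝ j ψ W y‖ ≤ D :=
    hK₀.exists_bound_of_continuousOn ((hψ.continuousOn_iteratedFDerivWithin (m := j)
      (by exact_mod_cast le_top) hW.uniqueDiffOn).mono hK₀W)
  choose D hD using hD
  -- The bound for derivatives of a composite asks for $\|D^j\psi\|\le D'^{\,j}$. The summand 1
  -- gives $D'\ge1$, hence $D'\le D'^{\,j}$ for $j\ge1$.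
  let D' : ℝ := 1 + ∑ j ∈ Finset.range (k + 1), |D j|
  have hD' : 1 ≤ D' := by
    have : 0 ≤ ∑ j ∈ Finset.range (k + 1), |D j| := Finset.sum_nonneg fun _ _ => abs_nonneg _
    simp only [D']
    linarith
  refine ⟨k.factorial * D' ^ k, by positivity, fun f y hy => ?_⟩
  have hyW := hK₀W hy
  have hf := contDiffOn_localRep q f
  have heq : Set.EqOn (localRep p f) (localRep q f ∘ ψ) W := by
    intro z hz
    change f (φ.symm z) = f (χ.symm (χ (φ.symm z)))
    rw [χ.left_inv hz.2.1]
  -- Derivatives within open sets are plain derivatives, so the chart target may be exchanged for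
  -- `W`, on which the change of charts is valid.
  rw [iteratedFDerivWithin_of_isOpen k φ.open_target hyW.1,
    ← iteratedFDerivWithin_of_isOpen k hW hyW,
    iteratedFDerivWithin_congr heq hyW]
  refine (norm_iteratedFDerivWithin_comp_le (n := k) (N := ∞) (D := D')
    (C := ∑ j ∈ Finset.range (k + 1), seminorms 𝕜 EM M ⟨q, ψ '' K₀, hK₁, hK₁', j⟩ f)
    hf hψ (by exact_mod_cast le_top) χ.open_target.uniqueDiffOn hW.uniqueDiffOn
    (fun z hz => χ.map_source hz.2.1) hyW (fun j hj => ?_) fun j hj hjk => ?_).trans_eq (by ring)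
  · refine (le_supDeriv χ.open_target hK₁ hK₁' j hf (Set.mem_image_of_mem ψ hy)).trans ?_
    exact Finset.single_le_sum (f := fun j => seminorms 𝕜 EM M ⟨q, ψ '' K₀, hK₁, hK₁', j⟩ f)
      (fun _ _ => apply_nonneg _ _) (Finset.mem_range.2 (by omega))
  · calc ‖iteratedFDerivWithin ℝ j ψ W y‖ ≤ |D j| := (hD j y hy).trans (le_abs_self _)
      _ ≤ ∑ j ∈ Finset.range (k + 1), |D j| := Finset.single_le_sum (f := fun j => |D j|)
        (fun _ _ => abs_nonneg _) (Finset.mem_range.2 (by omega))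
      _ ≤ D' := by simp [D']
      _ ≤ D' ^ j := le_self_pow₀ hD' (by omega)

/-- A linear map into `C^∞(M)` is continuous if the seminorms supported near the centres of the
charts are continuous along it. -/
theorem SmoothFn.continuous_of_continuous_local [FiniteDimensional ℝ EM] {S : Type*}
    [AddCommGroup S] [Module 𝕜 S] [TopologicalSpace S] [IsTopologicalAddGroup S]
    (L : S →ₗ[𝕜] SmoothFn 𝕜 EM M) {O : M → Set M} (hO : ∀ x, IsOpen (O x)) (hxO : ∀ x, x ∈ O x)
    (h : ∀ i : FnIndex EM M, Set.MapsTo (chartAt EM i.pt).symm i.K (O i.pt) →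
      Continuous fun s => seminorms 𝕜 EM M i (L s)) : Continuous L := by
  have hf := withSeminorms (𝕜 := 𝕜) (EM := EM) (M := M)
  have := hf.topologicalAddGroup
  refine hf.continuous_of_continuous_comp L fun i => ?_
  -- Each point of the compact set has a neighbourhood on which the chart centred at that point
  -- bounds the derivatives. Finitely many neighbourhoods cover, and the sum of their bounds
  -- dominates the seminorm.
  have key : ∀ y ∈ i.K, ∃ K₀ ∈ 𝓝 y, ∃ g : S → ℝ, Continuous g ∧ g 0 = 0 ∧ ∀ s, 0 ≤ g s ∧
      ∀ y ∈ K₀, ‖iteratedFDerivWithin ℝ i.order (localRep i.pt (L s))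
        (chartAt EM i.pt).target y‖ ≤ g s := by
    intro y hy
    obtain ⟨K₀, hK₀, j, hj, C, hC, hb⟩ := exists_norm_iteratedFDerivWithin_le (𝕜 := 𝕜) i.pt i.order
      (i.subset hy) (hO _) (hxO ((chartAt EM i.pt).symm y))
    refine ⟨K₀, hK₀, fun s => C * ∑ k ∈ Finset.range (i.order + 1), seminorms 𝕜 EM M (j k) (L s),
      ?_, by simp, fun s => ⟨mul_nonneg hC (Finset.sum_nonneg fun _ _ => apply_nonneg _ _),
        hb (L s)⟩⟩
    refine continuous_const.mul (continuous_finsetSum _ fun k _ => h (j k) ?_)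
    have := (hj k).2
    rwa [← (hj k).1] at this
  choose! K₀ hK₀ g hgc hg0 hg using key
  obtain ⟨t, ht, htK⟩ := i.isCompact.elim_nhds_subcover K₀ hK₀
  refine continuous_of_le_continuous _ (g := fun s => ∑ y ∈ t, g y s)
    (continuous_finsetSum _ fun y hy => hgc y (ht y hy))
    (Finset.sum_eq_zero fun y hy => hg0 y (ht y hy)) fun s => ?_
  have hn : ∀ y ∈ t, 0 ≤ g y s := fun y hy => (hg y (ht y hy) s).1
  refine Real.iSup_le (fun z => ?_) (Finset.sum_nonneg hn)
  obtain ⟨y, hy, hzy⟩ := Set.mem_iUnion₂.1 (htK z.2)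
  exact ((hg y (ht y hy) s).2 z hzy).trans (Finset.single_le_sum hn hy)

theorem chartDomain_dualBundle (x₀ : M) :
    chartDomain EM (F →L[𝕜] 𝕜) (DualBundle 𝕜 E) x₀ = chartDomain EM F E x₀ := by
  simp [chartDomain, hom_trivializationAt_baseSet]

variable [SmoothVectorBundle 𝕜 EM F E]

/-- In a trivialization and its dual the contraction is evaluation $F^*\times F\to\mathbb K$, a
bilinear map of norm at most one, so the Leibniz rule applies. -/
theorem seminorms_contraction_le (s : SmoothSection 𝕜 EM (F →L[𝕜] 𝕜) (DualBundle 𝕜 E))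
    (t : SmoothSection 𝕜 EM F E) (i : FnIndex EM M) (hi : i.K ⊆ chartDomain EM F E i.pt) :
    SmoothFn.seminorms 𝕜 EM M i (contraction s t) ≤
      ∑ j ∈ Finset.range (i.order + 1), (i.order.choose j : ℝ) *
        SmoothSection.seminorms 𝕜 EM (F →L[𝕜] 𝕜) (DualBundle 𝕜 E)
          ⟨i.pt, i.K, i.isCompact, hi.trans (chartDomain_dualBundle i.pt).ge, j⟩ s *
        SmoothSection.seminorms 𝕜 EM F E ⟨i.pt, i.K, i.isCompact, hi, i.order - j⟩ t := by
  have hU := isOpen_chartDomain (EM := EM) (F := F) (E := E) i.pt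
  have hT := (chartAt EM i.pt).open_target
  have hs := SmoothSection.contDiffOn_localRep i.pt s
  have ht := SmoothSection.contDiffOn_localRep i.pt t
  have hs' := hs
  rw [chartDomain_dualBundle] at hs'
  let B : (F →L[𝕜] 𝕜) →L[ℝ] F →L[ℝ] 𝕜 := ContinuousLinearMap.restrictScalarsL 𝕜 F 𝕜 ℝ ℝ
  have hB : ‖B‖ ≤ 1 := ContinuousLinearMap.opNorm_le_bound _ zero_le_one fun l => by
    rw [one_mul]
    exact (ContinuousLinearMap.norm_restrictScalars l).le
  have heq : Set.EqOn (SmoothFn.localRep i.pt (contraction s t))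
      (fun y => B (SmoothSection.localRep i.pt s y) (SmoothSection.localRep i.pt t y))
      (chartDomain EM F E i.pt) := by
    intro y hy
    simp only [SmoothSection.localRep, DualBundle.trivializationAt_apply]
    change s _ (t _) = s _ ((trivializationAt F E i.pt).symmL 𝕜 _ _)
    rw [Bundle.Trivialization.symmL_apply _ hy.2, Bundle.Trivialization.symm_apply_apply_mk _ hy.2]
  refine Real.iSup_le (fun y => ?_) (Finset.sum_nonneg fun j _ => by positivity)
  have hy := hi y.2
  rw [iteratedFDerivWithin_of_isOpen _ hT hy.1, ← iteratedFDerivWithin_of_isOpen _ hU hy,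
    iteratedFDerivWithin_congr heq hy]
  refine (B.norm_iteratedFDerivWithin_le_of_bilinear_of_le_one hs' ht hU.uniqueDiffOn hy
    (by exact_mod_cast le_top) hB).trans (Finset.sum_le_sum fun j _ => ?_)
  have h₁ : ‖iteratedFDerivWithin ℝ j (SmoothSection.localRep i.pt s)
      (chartDomain EM F E i.pt) y‖ ≤ SmoothSection.seminorms 𝕜 EM (F →L[𝕜] 𝕜) (DualBundle 𝕜 E)
          ⟨i.pt, i.K, i.isCompact, hi.trans (chartDomain_dualBundle i.pt).ge, j⟩ s := by
    have := le_supDeriv (isOpen_chartDomain (EM := EM) (F := F →L[𝕜] 𝕜) (E := DualBundle 𝕜 E) i.pt)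
      i.isCompact (hi.trans (chartDomain_dualBundle i.pt).ge) j hs y.2
    exact (congrArg (fun U : Set EM =>
      ‖iteratedFDerivWithin ℝ j (SmoothSection.localRep i.pt s) U y‖)
      (chartDomain_dualBundle i.pt).symm).trans_le this
  have h₂ : ‖iteratedFDerivWithin ℝ (i.order - j) (SmoothSection.localRep i.pt t)
      (chartDomain EM F E i.pt) y‖ ≤
      SmoothSection.seminorms 𝕜 EM F E ⟨i.pt, i.K, i.isCompact, hi, i.order - j⟩ t :=
    le_supDeriv hU i.isCompact hi _ ht y.2
  gcongr

variable (𝕜 EM F E) in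
/-- The contraction as a bilinear map. -/
noncomputable def contractionₗ :
    SmoothSection 𝕜 EM (F →L[𝕜] 𝕜) (DualBundle 𝕜 E) →ₗ[SmoothFn 𝕜 EM M]
    SmoothSection 𝕜 EM F E →ₗ[SmoothFn 𝕜 EM M] SmoothFn 𝕜 EM M :=
  LinearMap.mk₂ _ contraction
    (fun _ _ _ => ContMDiffMap.ext fun _ => rfl)
    (fun _ _ _ => ContMDiffMap.ext fun _ => rfl)
    (fun s _ _ => ContMDiffMap.ext fun x => (s x).map_add _ _)
    (fun _ s _ => ContMDiffMap.ext fun x => (s x).map_smul _ _)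

theorem continuous_contraction_right [FiniteDimensional ℝ EM]
    (s : SmoothSection 𝕜 EM (F →L[𝕜] 𝕜) (DualBundle 𝕜 E)) :
    Continuous fun t : SmoothSection 𝕜 EM F E => contraction s t := by
  have ht := SmoothSection.withSeminorms (𝕜 := 𝕜) (EM := EM) (F := F) (E := E)
  have := ht.topologicalAddGroup
  refine SmoothFn.continuous_of_continuous_local
    ((contractionₗ 𝕜 EM F E s).restrictScalars 𝕜) (O := fun x => (trivializationAt F E x).baseSet)
    (fun x => (trivializationAt F E x).open_baseSet)
    FiberBundle.mem_baseSet_trivializationAt' fun i hi => ?_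
  refine continuous_of_le_continuous ((SmoothFn.seminorms 𝕜 EM M i).comp
    ((contractionₗ 𝕜 EM F E s).restrictScalars 𝕜)) ?_ ?_ fun t =>
      seminorms_contraction_le s t i fun y hy => ⟨i.subset hy, hi hy⟩
  · exact continuous_finsetSum _ fun j _ => continuous_const.mul (ht.continuous_seminorm _)
  · simp

theorem continuous_contraction_left [FiniteDimensional ℝ EM] (t : SmoothSection 𝕜 EM F E) :
    Continuous fun s : SmoothSection 𝕜 EM (F →L[𝕜] 𝕜) (DualBundle 𝕜 E) => contraction s t := by
  have hs := SmoothSection.withSeminorms (𝕜 := 𝕜) (EM := EM) (F := F →L[𝕜] 𝕜) (E := DualBundle 𝕜 E)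
  have := hs.topologicalAddGroup
  let L := ((contractionₗ 𝕜 EM F E).flip t).restrictScalars 𝕜
  refine SmoothFn.continuous_of_continuous_local
    L (O := fun x => (trivializationAt F E x).baseSet)
    (fun x => (trivializationAt F E x).open_baseSet)
    FiberBundle.mem_baseSet_trivializationAt' fun i hi => ?_
  refine continuous_of_le_continuous ((SmoothFn.seminorms 𝕜 EM M i).comp L) ?_ ?_ fun s =>
      seminorms_contraction_le s t i fun y hy => ⟨i.subset hy, hi hy⟩
  · exact continuous_finsetSum _ fun j _ =>
      (continuous_const.mul (hs.continuous_seminorm _)).mul continuous_const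
  · simp

end Contraction

/-! ### Locally convex modules with a finite dual basis -/

section Module

variable {𝕜 A H K P Q : Type*} [RCLike 𝕜] [CommRing A] [Algebra 𝕜 A] [TopologicalSpace A]
  [AddCommGroup H] [Module 𝕜 H] [Module A H] [IsScalarTower 𝕜 A H] [TopologicalSpace H]
  [AddCommGroup K] [Module 𝕜 K] [Module A K] [IsScalarTower 𝕜 A K] [TopologicalSpace K]
  [AddCommGroup P] [Module 𝕜 P] [Module A P] [IsScalarTower 𝕜 A P] [TopologicalSpace P]
  [AddCommGroup Q] [Module A Q] [TopologicalSpace Q]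

/-- Used twice: for the Hom space inside a power of its target, and for the tensor product through
$\Phi$. -/
theorem LocallyConvexModule.of_isEmbedding (hK : LocallyConvexModule 𝕜 A K) (f : H →ₗ[A] K)
    (hf : Topology.IsEmbedding f) : LocallyConvexModule 𝕜 A H where
  polynormableSpace :=
    haveI := hK.polynormableSpace
    Topology.IsInducing.polynormableSpace (f := f.restrictScalars 𝕜) hf.isInducing
  t2Space := haveI := hK.t2Space; hf.t2Space
  continuous_smul_right a := by
    simpa [hf.continuous_iff, Function.comp_def] using
      (hK.continuous_smul_right a).comp hf.continuous
  continuous_smul_left x := by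
    simpa [hf.continuous_iff, Function.comp_def] using hK.continuous_smul_left (f x)

theorem LocallyConvexModule.pi {ι : Type*} (hK : LocallyConvexModule 𝕜 A K) :
    LocallyConvexModule 𝕜 A (ι → K) where
  polynormableSpace := haveI := hK.polynormableSpace; inferInstance
  t2Space := haveI := hK.t2Space; inferInstance
  continuous_smul_right a := continuous_pi fun i =>
    (hK.continuous_smul_right a).comp (continuous_apply i)
  continuous_smul_left x := continuous_pi fun i => hK.continuous_smul_left (x i)

/-- The continuous linear maps into a locally convex module, with the topology of simple
convergence, form a locally convex module. -/
theorem SimpleHom.locallyConvexModule [hK : LocallyConvexModule 𝕜 A K] :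
    LocallyConvexModule 𝕜 A (SimpleHom 𝕜 A Q K) :=
  (hK.pi (ι := Q)).of_isEmbedding
    { toFun := fun ℓ s => ℓ s
      map_add' := fun _ _ => rfl
      map_smul' := fun _ _ => rfl } ⟨⟨rfl⟩, DFunLike.coe_injective⟩

theorem SimpleHom.continuous_eval [LocallyConvexModule 𝕜 A K] (s : Q) :
    Continuous fun ℓ : SimpleHom 𝕜 A Q K => ℓ s :=
  (continuous_apply s).comp continuous_induced_dom

theorem InductiveTensorOver.smul_tmul [LocallyConvexModule 𝕜 A P] (a : A) (x : P) (h : H) :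
    (tmul (a • x) h : InductiveTensorOver 𝕜 A P H) = tmul x (a • h) :=
  (Submodule.Quotient.eq _).2 (Submodule.le_topologicalClosure _
    (Submodule.subset_span ⟨a, x, h, rfl⟩))

/-! ### Modules in duality through a separately continuous pairing -/

section Pairing

variable [LocallyConvexModule 𝕜 A P] [hH : LocallyConvexModule 𝕜 A H]
  (β : Q →ₗ[A] P →ₗ[A] A) (hβ₁ : ∀ t, Continuous fun s => β s t)

/-- The map `P ⊗ H → L(Q, H)`, `t ⊗ h ↦ (s ↦ β s t • h)`, for a separately continuous pairing
`β` of `Q` and `P`. -/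
noncomputable def InductiveTensor.toSimpleHom :
    InductiveTensor 𝕜 P H →ₗ[A] SimpleHom 𝕜 A Q H :=
  TensorProduct.AlgebraTensorModule.lift
    { toFun := fun t =>
        { toFun := fun h => (⟨(β.flip t).smulRight h, (hH.continuous_smul_left h).comp (hβ₁ t)⟩ :
            Q →L[A] H)
          map_add' := fun h h' => DFunLike.ext (F := Q →L[A] H) _ _ fun s => smul_add _ _ _
          map_smul' := fun c h => DFunLike.ext (F := Q →L[A] H) _ _ fun s =>
            haveI : SMulCommClass A 𝕜 H := IsScalarTower.to_smulCommClass'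
            smul_comm (β s t) c h }
      map_add' := fun t t' => LinearMap.ext fun h => DFunLike.ext (F := Q →L[A] H) _ _ fun s => by
        change β s (t + t') • h = β s t • h + β s t' • h
        rw [map_add, add_smul]
      map_smul' := fun a t => LinearMap.ext fun h => DFunLike.ext (F := Q →L[A] H) _ _ fun s => by
        change β s (a • t) • h = a • β s t • h
        rw [map_smul, smul_eq_mul, mul_smul] }

/-- Universal property of the inductive topology: the topology pulled back from the Hom space is
locally convex and makes $\otimes$ separately continuous, so it is coarser than the finest such
topology. -/
theorem InductiveTensor.continuous_toSimpleHom (hβ₂ : ∀ s, Continuous (β s)) :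
    Continuous (toSimpleHom (𝕜 := 𝕜) (H := H) β hβ₁) := by
  have := (SimpleHom.locallyConvexModule (𝕜 := 𝕜) (A := A) (Q := Q) (K := H)).polynormableSpace
  rw [continuous_iff_le_induced]
  refine sInf_le ⟨PolynormableSpace.induced ((toSimpleHom (𝕜 := 𝕜) β hβ₁).restrictScalars 𝕜),
    fun t => ?_, fun h => ?_⟩
  · rw [continuous_induced_rng, continuous_induced_rng]
    exact continuous_pi fun s => hH.continuous_smul_right (β s t)
  · rw [continuous_induced_rng, continuous_induced_rng]
    exact continuous_pi fun s => (hH.continuous_smul_left h).comp (hβ₂ s)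

/-- The map `P ⊗_A H → L_A(Q, H)`, `t ⊗ h ↦ (s ↦ β s t • h)`. -/
noncomputable def InductiveTensorOver.toSimpleHom (hβ₂ : ∀ s, Continuous (β s)) :
    InductiveTensorOver 𝕜 A P H →ₗ[A] SimpleHom 𝕜 A Q H :=
  Submodule.liftQ _ (InductiveTensor.toSimpleHom (𝕜 := 𝕜) β hβ₁) <| by
    have hc := InductiveTensor.continuous_toSimpleHom (𝕜 := 𝕜) (H := H) β hβ₁ hβ₂
    have := (SimpleHom.locallyConvexModule (𝕜 := 𝕜) (A := A) (Q := Q) (K := H)).t2Space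
    -- The kernel of a continuous map into a Hausdorff space is closed, so only the generators need
    -- checking.
    refine Submodule.topologicalClosure_minimal _ (Submodule.span_le.2 ?_)
      (isClosed_singleton.preimage hc)
    rintro _ ⟨a, t, h, rfl⟩
    refine LinearMap.mem_ker.2 ((map_sub _ _ _).trans (sub_eq_zero.2 ?_))
    refine DFunLike.ext (F := Q →L[A] H) _ _ fun s => ?_
    change β s (a • t) • h = β s t • a • h
    rw [map_smul, smul_eq_mul, mul_comm, mul_smul]

/-- If `P` and `Q` have dual bases with respect to the pairing `β`, then `P ⊗_A H` is isomorphic to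
`L_A(Q, H)`. -/
theorem exists_inductiveTensorOver_equiv_simpleHom (hβ₁ : ∀ t, Continuous fun s => β s t)
    (hβ₂ : ∀ s, Continuous (β s)) {ι : Type*} [Fintype ι] (t : ι → P) (s : ι → Q)
    (ht : ∀ t', ∑ j, β (s j) t' • t j = t') (hs : ∀ s', ∑ j, β s' (t j) • s j = s') :
    ∃ Φ : InductiveTensorOver 𝕜 A P H ≃L[A] SimpleHom 𝕜 A Q H,
      ∀ (t' : P) (h : H) (s' : Q), Φ (InductiveTensorOver.tmul t' h) s' = β s' t' • h := by
  let Φ := InductiveTensorOver.toSimpleHom (𝕜 := 𝕜) (H := H) β hβ₁ hβ₂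
  -- The inverse before passing to the quotient. It is set up as an additive map only: `A` acts here
  -- on the left factor, while scaling `ℓ` acts on the right one, and the two are identified only in
  -- the quotient.
  let Ψ₀ : SimpleHom 𝕜 A Q H →+ InductiveTensor 𝕜 P H :=
    { toFun := fun ℓ => ∑ j, InductiveTensor.tmul (t j) (ℓ (s j))
      map_zero' := Finset.sum_eq_zero fun j _ => TensorProduct.tmul_zero _ _
      map_add' := fun ℓ ℓ' => (Finset.sum_congr rfl fun j _ => TensorProduct.tmul_add _ _ _).trans
        Finset.sum_add_distrib }
  let mk : InductiveTensor 𝕜 P H →ₗ[A] InductiveTensorOver 𝕜 A P H := Submodule.mkQ _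
  have hΨ₀ : Continuous Ψ₀ := continuous_finsetSum _ fun j _ =>
    (InductiveTensor.sInf_mem_admissibleTopologies.2.1 (t j)).comp (SimpleHom.continuous_eval (s j))
  have hΦ (t' : P) (h : H) (s' : Q) : Φ (InductiveTensorOver.tmul t' h) s' = β s' t' • h := rfl
  have hleft (t' : P) (h : H) :
      mk (Ψ₀ (Φ (InductiveTensorOver.tmul t' h))) = InductiveTensorOver.tmul t' h := by
    calc mk (Ψ₀ (Φ (InductiveTensorOver.tmul t' h)))
        = ∑ j, InductiveTensorOver.tmul (t j) (β (s j) t' • h) := map_sum mk _ _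
      _ = ∑ j, InductiveTensorOver.tmul (β (s j) t' • t j) h :=
        Finset.sum_congr rfl fun j _ => (InductiveTensorOver.smul_tmul _ _ _).symm
      _ = mk (InductiveTensor.tmul (∑ j, β (s j) t' • t j) h) :=
        ((congrArg mk (TensorProduct.sum_tmul _ _ _)).trans (map_sum mk _ _)).symm
      _ = InductiveTensorOver.tmul t' h := by rw [ht]; rfl
  refine ⟨⟨⟨Φ, fun ℓ => mk (Ψ₀ ℓ), fun z => ?_, fun ℓ => ?_⟩, ?_, ?_⟩, hΦ⟩
  -- Both sides are additive in a representative, so elementary tensors suffice.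
  · obtain ⟨z, rfl⟩ := Submodule.mkQ_surjective _ z
    induction z using TensorProduct.induction_on with
    | zero =>
      exact map_zero
        ((mk.toAddMonoidHom.comp Ψ₀).comp (Φ.toAddMonoidHom.comp mk.toAddMonoidHom))
    | tmul t' h => exact hleft t' h
    | add z z' hz hz' =>
      exact (map_add ((mk.toAddMonoidHom.comp Ψ₀).comp
        (Φ.toAddMonoidHom.comp mk.toAddMonoidHom)) z z').trans (congrArg₂ (· + ·) hz hz')
  · refine DFunLike.ext (F := Q →L[A] H) _ _ fun s' => ?_
    have hsum : ∀ (S : Finset ι), InductiveTensor.toSimpleHom (𝕜 := 𝕜) β hβ₁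
        (∑ j ∈ S, InductiveTensor.tmul (t j) (ℓ (s j))) s' = ∑ j ∈ S, β s' (t j) • ℓ (s j) := by
      intro S
      exact (map_sum ((⟨⟨fun ℓ => ℓ s', rfl⟩, fun _ _ => rfl⟩ : SimpleHom 𝕜 A Q H →+ H).comp
        (InductiveTensor.toSimpleHom (𝕜 := 𝕜) β hβ₁).toAddMonoidHom) _ S)
    refine (hsum Finset.univ).trans ?_
    let ℓ' : Q →L[A] H := ℓ
    change ∑ j, β s' (t j) • ℓ' (s j) = ℓ' s'
    conv_rhs => rw [← hs s', map_sum]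
    simp only [map_smul]
  · exact isQuotientMap_quot_mk.continuous_iff.2
      (InductiveTensor.continuous_toSimpleHom (𝕜 := 𝕜) (H := H) β hβ₁ hβ₂)
  · exact continuous_quot_mk.comp hΨ₀

end Pairing

end Module

theorem mainTheorem3 {𝕜 EM M F : Type*} {E : M → Type*} {H : Type*} [RCLike 𝕜]
    -- a smooth, Hausdorff, second countable, finite dimensional manifold `M`
    [NormedAddCommGroup EM] [NormedSpace ℝ EM] [FiniteDimensional ℝ EM]
    [TopologicalSpace M] [ChartedSpace EM M] [IsManifold 𝓘(ℝ, EM) ∞ M]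
    [T2Space M] [SecondCountableTopology M]
    -- a smooth `𝕜`-vector bundle `E` over `M` with finite dimensional typical fibre `F`
    [NormedAddCommGroup F] [NormedSpace ℝ F] [NormedSpace 𝕜 F] [IsScalarTower ℝ 𝕜 F]
    [FiniteDimensional 𝕜 F]
    [∀ x, AddCommGroup (E x)] [∀ x, Module 𝕜 (E x)] [∀ x, TopologicalSpace (E x)]
    [TopologicalSpace (Bundle.TotalSpace F E)] [FiberBundle F E] [VectorBundle 𝕜 F E]
    [SmoothVectorBundle 𝕜 EM F E]
    -- a locally convex `C^∞(M)`-module `H`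
    [AddCommGroup H] [Module 𝕜 H] [Module (SmoothFn 𝕜 EM M) H]
    [IsScalarTower 𝕜 (SmoothFn 𝕜 EM M) H] [TopologicalSpace H]
    [LocallyConvexModule 𝕜 (SmoothFn 𝕜 EM M) H] :
    LocallyConvexModule 𝕜 (SmoothFn 𝕜 EM M)
      (InductiveTensorOver 𝕜 (SmoothFn 𝕜 EM M) (SmoothSection 𝕜 EM F E) H) ∧
    LocallyConvexModule 𝕜 (SmoothFn 𝕜 EM M)
      (SimpleHom 𝕜 (SmoothFn 𝕜 EM M)
        (SmoothSection 𝕜 EM (F →L[𝕜] 𝕜) (DualBundle 𝕜 E)) H) ∧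
    ∃ Φ : InductiveTensorOver 𝕜 (SmoothFn 𝕜 EM M) (SmoothSection 𝕜 EM F E) H
        ≃L[SmoothFn 𝕜 EM M]
        SimpleHom 𝕜 (SmoothFn 𝕜 EM M)
          (SmoothSection 𝕜 EM (F →L[𝕜] 𝕜) (DualBundle 𝕜 E)) H,
      ∀ (t : SmoothSection 𝕜 EM F E) (h : H)
        (s : SmoothSection 𝕜 EM (F →L[𝕜] 𝕜) (DualBundle 𝕜 E)),
        Φ (InductiveTensorOver.tmul t h) s = contraction s t • h := by
  have hS := SimpleHom.locallyConvexModule (𝕜 := 𝕜) (A := SmoothFn 𝕜 EM M)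
    (Q := SmoothSection 𝕜 EM (F →L[𝕜] 𝕜) (DualBundle 𝕜 E)) (K := H)
  obtain ⟨N, t, s, ht, hs⟩ := SmoothSection.exists_finite_dualBasis 𝕜 EM F E
  obtain ⟨Φ, hΦ⟩ := exists_inductiveTensorOver_equiv_simpleHom (𝕜 := 𝕜) (H := H)
    (contractionₗ 𝕜 EM F E) continuous_contraction_left continuous_contraction_right t s ht hs
  -- The tensor product is a locally convex module because $\Phi$ embeds it linearly into one.
  exact ⟨hS.of_isEmbedding (Φ : _ →ₗ[SmoothFn 𝕜 EM M] _) Φ.toHomeomorph.isEmbedding, hS, Φ, hΦ⟩
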